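/- Conventions. In a rack write $x^y=x\rhd y$, $x^{\bar y}=x\rhd^{-1}y$, $x^{uv}=(x^u)^v$. For $S=\{x_1,\dots,x_g\}$ and a finite list $R$ of relations $x_i^{u}=x_j$ ($u$ a reduced word in the free group $F(S)$, $\bar u$ its inverse), $\langle S\mid R\rangle$ is the quotient of the free rack on $S$ by the smallest congruence containing $R$. Let $\bar S=\{\bar x_1,\dots,\bar x_g\}$; the elements of $S\cup\bar S$ are always taken in the order $x_1,\dots,x_g,\bar x_1,\dots,\bar x_g$, and $\bar{\bar x}=x$. An enumeration table consists of a number $\omega$ of rows, a partial function $(i,y)\mapsto i^y$ from $\{1,\dots,\omega\}\times(S\cup\bar S)$ to $\{1,\dots,\omega\}$, a function $\tau$ from $\{1,\dots,\omega\}$ to $\langle S\mid R\rangle$, and a function $\rho$ from $\{1,\dots,\omega\}$ to itself with $\rho(i)\le i$. Its live elements are $\Omega=\{i:\rho(i)=i\}$, and $\mathrm{Rep}(i)$ is the least element of $\{i,\rho(i),\rho(\rho(i)),\dots\}$. The following operations change the table. * $\mathrm{Define}(i,y)$: increase $\omega$ by $1$; put $i^y:=\omega$, $\omega^{\bar y}:=i$,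 $\tau(\omega):=\tau(i)^y$, $\rho(\omega):=\omega$. * $\mathrm{Deduction}(i,y,j)$: put $i^y:=j$, $j^{\bar y}:=i$. * $\mathrm{Update}(i)$: put $\rho(n):=\mathrm{Rep}(i)$ for all $n$ in $\{i,\rho(i),\rho(\rho(i)),\dots\}$. * $\mathrm{Merge}(m,n)$, for a queue $Q$: let $\mu=\mathrm{Rep}(m)$, $\nu=\mathrm{Rep}(n)$; if $\mu\ne\nu$, append $\max(\mu,\nu)$ to $Q$ and put $\rho(\max(\mu,\nu)):=\min(\mu,\nu)$. * $\mathrm{Coincidence}(m,n)$: start with the empty queue $Q$ and call $\mathrm{Merge}(m,n)$. As long as $Q$ is not empty, take its first element $d$ off, and for each $x\in S\cup\bar S$ such that $d^x=e$ is defined: undefine $d^x$ and $e^{\bar x}$; let $\delta=\mathrm{Rep}(d)$ and call $\mathrm{Update}(d)$; let $\varepsilon=\mathrm{Rep}(e)$ and call $\mathrm{Update}(e)$; then, if $\delta^x$ is defined, call $\mathrm{Merge}(\varepsilon,\delta^x)$; otherwise, if $\varepsilon^{\bar x}$ is defined, call $\mathrm{Merge}(\delta,\varepsilon^{\bar x})$;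 otherwise put $\delta^x:=\varepsilon$, $\varepsilon^{\bar x}:=\delta$. * $\mathrm{Scan}(i,y_1\cdots y_t,j)$: start with $f=1$, $b=t$, $k=i$, $\ell=j$. As long as $f\le b$, repeat: while $f\le b$ and $k^{y_f}$ is defined, replace $k$ by $k^{y_f}$ and $f$ by $f+1$; then, while $f\le b$ and $\ell^{\bar y_b}$ is defined, replace $\ell$ by $\ell^{\bar y_b}$ and $b$ by $b-1$; then, if $f<b$, call $\mathrm{Define}(k,y_f)$ and continue; if $f=b$, call $\mathrm{Deduction}(k,y_f,\ell)$ and stop; if $f>b$, call $\mathrm{Coincidence}(k,\ell)$ in case $k\neq\ell$, and stop. The procedure $W(S,R,M)$ with run limit $M\in\mathbb N$ (the rack enumeration procedure without Ward's modification) is the following. Let $R_2$ be the list, without repetitions and in the order of $R$, of the reduced forms of the words $\bar u x_i u\bar x_j$ for $x_i^u=x_j$ in $R$. Start with the table with $\omega=g$, no entries, $\tau(i)=x_i$ and $\rho(i)=i$. For each relation $x_i^u=x_j$ in $R$, in order, call $\mathrm{Scan}(\mathrm{Rep}(i),u,\mathrm{Rep}(j))$. Then put $i:=1$ and, while $i\le\max\Omega$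 and $i\le M$, do: for each $w\in R_2$, in order, call $\mathrm{Scan}(i,w,i)$, leaving this inner loop as soon as $i\notin\Omega$; then replace $i$ by $i+1$. (With Ward's modification, one would also call, before replacing $i$, $\mathrm{Define}(i,y)$ for every $y\in S\cup\bar S$ with $i^y$ undefined, provided that $i\in\Omega$.) When the while loop ends, $W(S,R,M)$ *completes* if $i>\max\Omega$; otherwise the run limit is exceeded. **Proposition.** Let $S=\{a,b\}$ with $x_1=a$, $x_2=b$, and let $R$ be the list of relations $$a^a=a,\qquad b^b=b,\qquad a^{baba\bar b}=a,\qquad b^{baba\bar b}=b .$$ Then the rack $\langle S\mid R\rangle$ is finite, but there is no $M$ for which $W(S,R,M)$ completes. -/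

import Mathlib

open Quandles

namespace RackEnum

/-! ### Rack presentations

Mathlib writes racks as left actions: the element `x ▷ y = x ^ y` of the right-handed convention
is `y ◃ x`, and `x ▷⁻¹ y` is `y ◃⁻¹ x`. -/

/-- The free rack on `X`: its elements are the formal expressions `a ^ u`, with `a ∈ X` and `u` in
the free group on `X`. -/
@[ext] structure FreeRack (X : Type*) where
  base : X
  exponent : FreeGroup X

/-- `a ^ u ▷ b ^ v = a ^ (u v⁻¹ b v)` and `a ^ u ▷⁻¹ b ^ v = a ^ (u v⁻¹ b⁻¹ v)`. -/
instance FreeRack.instRack (X : Type*) : Rack (FreeRack X) where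
  act q p := ⟨p.base, p.exponent * q.exponent⁻¹ * FreeGroup.of q.base * q.exponent⟩
  invAct q p := ⟨p.base, p.exponent * q.exponent⁻¹ * (FreeGroup.of q.base)⁻¹ * q.exponent⟩
  self_distrib := by
    intro x y z
    ext
    · rfl
    · simp only; group
  left_inv := by
    intro x y
    ext
    · rfl
    · simp only; group
  right_inv := by
    intro x y
    ext
    · rfl
    · simp only; group

/-- A primary relation `x_lhs ^ word = x_rhs` between generators `x_1, …, x_g`
(indexed by `Fin g`). -/
structure Relation (g : ℕ) where
  lhs : Fin g
  word : FreeGroup (Fin g)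
  rhs : Fin g

/-- The smallest congruence on the free rack that contains the relations in `R`. -/
inductive Congr {g : ℕ} (R : List (Relation g)) : FreeRack (Fin g) → FreeRack (Fin g) → Prop
  | rel (r : Relation g) (hr : r ∈ R) : Congr R ⟨r.lhs, r.word⟩ ⟨r.rhs, 1⟩
  | refl (p : FreeRack (Fin g)) : Congr R p p
  | symm {p q : FreeRack (Fin g)} : Congr R p q → Congr R q p
  | trans {p q r : FreeRack (Fin g)} : Congr R p q → Congr R q r → Congr R p r
  | act {p p' q q' : FreeRack (Fin g)} : Congr R p p' → Congr R q q' → Congr R (p ◃ q) (p' ◃ q')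
  | invAct {p p' q q' : FreeRack (Fin g)} :
      Congr R p p' → Congr R q q' → Congr R (p ◃⁻¹ q) (p' ◃⁻¹ q')

/-- The congruence generated by `R`, as a setoid. -/
def congrSetoid {g : ℕ} (R : List (Relation g)) : Setoid (FreeRack (Fin g)) :=
  ⟨Congr R, ⟨Congr.refl, Congr.symm, Congr.trans⟩⟩

/-- The rack `⟨ x_1, …, x_g ∣ R ⟩`. -/
def PresentedRack {g : ℕ} (R : List (Relation g)) : Type :=
  Quotient (congrSetoid R)

instance PresentedRack.instRack {g : ℕ} (R : List (Relation g)) : Rack (PresentedRack R) where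
  act := Quotient.map₂ (fun p q => p ◃ q) (fun _ _ h _ _ h' => Congr.act h h')
  invAct := Quotient.map₂ (fun p q => p ◃⁻¹ q) (fun _ _ h _ _ h' => Congr.invAct h h')
  self_distrib := by
    rintro ⟨x⟩ ⟨y⟩ ⟨z⟩
    exact congrArg (Quotient.mk (congrSetoid R)) Shelf.self_distrib
  left_inv := by
    rintro ⟨x⟩ ⟨y⟩
    exact congrArg (Quotient.mk (congrSetoid R)) (Rack.left_inv x y)
  right_inv := by
    rintro ⟨x⟩ ⟨y⟩
    exact congrArg (Quotient.mk (congrSetoid R)) (Rack.right_inv x y)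

/-- The class of the generator `x_i` in the presented rack. -/
def PresentedRack.gen {g : ℕ} (R : List (Relation g)) (i : Fin g) : PresentedRack R :=
  Quotient.mk (congrSetoid R) ⟨i, 1⟩

/-! ### Letters and words -/

/-- An element of `S ∪ S̄`: `(i, true)` is the generator `x_i` and `(i, false)` its inverse. -/
abbrev Letter (g : ℕ) : Type := Fin g × Bool

/-- The inverse of a letter. -/
def Letter.bar {g : ℕ} (y : Letter g) : Letter g := (y.1, !y.2)

/-- All letters in the order `x_1, …, x_g, x̄_1, …, x̄_g`. -/
def letters (g : ℕ) : List (Letter g) :=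
  (List.finRange g).map (fun i => (i, true)) ++ (List.finRange g).map (fun i => (i, false))

/-- `p ^ y` in the presented rack, for a letter `y`. -/
def PresentedRack.actLetter {g : ℕ} {R : List (Relation g)} (p : PresentedRack R) (y : Letter g) :
    PresentedRack R :=
  if y.2 then PresentedRack.gen R y.1 ◃ p else PresentedRack.gen R y.1 ◃⁻¹ p

/-- The reduced secondary word `ū x_i u x̄_j` of the primary relation `x_i ^ u = x_j`. -/
def secondaryWord {g : ℕ} (r : Relation g) : List (Letter g) :=
  (r.word⁻¹ * FreeGroup.of r.lhs * r.word * (FreeGroup.of r.rhs)⁻¹).toWord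

/-- The set of secondary words, listed without repetition in the order of the relations. -/
def secondaryWords {g : ℕ} (R : List (Relation g)) : List (List (Letter g)) :=
  R.foldl (fun R₂ r => if secondaryWord r ∈ R₂ then R₂ else R₂ ++ [secondaryWord r]) []

/-! ### Enumeration tables -/

/-- An enumeration table. The rows are `1, …, ω`; the value of a field at other rows is
irrelevant. `A i y` is the entry `i ^ y`, and `none` stands for an undefined entry. -/
structure Table {g : ℕ} (R : List (Relation g)) where
  ω : ℕ
  A : ℕ → Letter g → Option ℕ
  τ : ℕ → Option (PresentedRack R)
  ρ : ℕ → ℕ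

variable {g : ℕ} {R : List (Relation g)}

/-- The initial table: `g` rows, no entries, `τ(i) = x_i` and `ρ(i) = i`. -/
def initTable (R : List (Relation g)) : Table R where
  ω := g
  A := fun _ _ => none
  τ := fun i => if h : 1 ≤ i ∧ i ≤ g then some (PresentedRack.gen R ⟨i - 1, by omega⟩) else none
  ρ := fun i => i

/-- The live elements `Ω`. -/
def Table.live (T : Table R) : Finset ℕ :=
  (Finset.Icc 1 T.ω).filter (fun i => T.ρ i = i)

/-- The largest live element. -/
def Table.maxLive (T : Table R) : ℕ := T.live.sup id

/-- Change the single entry `i ^ y`. -/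
def setEntry (A : ℕ → Letter g → Option ℕ) (i : ℕ) (y : Letter g) (v : Option ℕ) :
    ℕ → Letter g → Option ℕ :=
  fun i' y' => if i' = i ∧ y' = y then v else A i' y'

/-- `i ^ y := j` and `j ^ ȳ := i`. -/
def Table.addPair (T : Table R) (i : ℕ) (y : Letter g) (j : ℕ) : Table R :=
  { T with A := setEntry (setEntry T.A i y (some j)) j y.bar (some i) }

/-- Undefine `i ^ y` and `j ^ ȳ`. -/
def Table.removePair (T : Table R) (i : ℕ) (y : Letter g) (j : ℕ) : Table R :=
  { T with A := setEntry (setEntry T.A i y none) j y.bar none }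

/-! ### The subroutines -/

/-- `Define`: add a new row `ω + 1` and set `i ^ y` equal to it. -/
def Table.define (T : Table R) (i : ℕ) (y : Letter g) : Table R where
  ω := T.ω + 1
  A := setEntry (setEntry T.A i y (some (T.ω + 1))) (T.ω + 1) y.bar (some i)
  τ := Function.update T.τ (T.ω + 1) ((T.τ i).map (fun p => p.actLetter y))
  ρ := Function.update T.ρ (T.ω + 1) (T.ω + 1)

/-- `Deduction`: record `i ^ y = j`. -/
def Table.deduction (T : Table R) (i : ℕ) (y : Letter g) (j : ℕ) : Table R :=
  T.addPair i y j

/-- `Rep`: follow `ρ` as long as it decreases. -/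
def rep (ρ : ℕ → ℕ) (i : ℕ) : ℕ :=
  if ρ i < i then rep ρ (ρ i) else i
termination_by i

/-- The loop of `Update`: set `ρ` to `ε` along the orbit of `n`. -/
def updateLoop (ε : ℕ) (ρ : ℕ → ℕ) (n : ℕ) : ℕ → ℕ :=
  if ρ n < n then updateLoop ε (Function.update ρ n ε) (ρ n) else ρ
termination_by n

/-- `Update`: set `ρ(j) = Rep(i)` for all `j` in the orbit of `i`. -/
def Table.update (T : Table R) (i : ℕ) : Table R :=
  { T with ρ := updateLoop (rep T.ρ i) T.ρ i }

/-- `Merge`, acting on the table and the queue of coincidences. -/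
def merge (T : Table R) (Q : List ℕ) (m n : ℕ) : Table R × List ℕ :=
  let μ := rep T.ρ m
  let ν := rep T.ρ n
  if μ ≠ ν then
    ({ T with ρ := Function.update T.ρ (max μ ν) (min μ ν) }, Q ++ [max μ ν])
  else (T, Q)

/-- The body of the loop over `x ∈ S ∪ S̄` in `Coincidence`, for the dead row `d`. -/
def relocate (d : ℕ) (s : Table R × List ℕ) (x : Letter g) : Table R × List ℕ :=
  match s.1.A d x with
  | none => s
  | some e =>
    let T₁ := s.1.removePair d x e
    let δ := rep T₁.ρ d
    let T₂ := T₁.update d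
    let ε := rep T₂.ρ e
    let T₃ := T₂.update e
    match T₃.A δ x with
    | some f => merge T₃ s.2 ε f
    | none =>
      match T₃.A ε x.bar with
      | some f => merge T₃ s.2 δ f
      | none => (T₃.addPair δ x ε, s.2)

/-- The while loop of `Coincidence`; the second component is the part of the queue that has not
been taken off yet. The first argument bounds the number of rounds. -/
def resolve : ℕ → Table R × List ℕ → Table R × List ℕ
  | 0, s => s
  | _ + 1, (T, []) => (T, [])
  | n + 1, (T, d :: Q) => resolve n ((letters g).foldl (relocate d) (T, Q))

/-- `Coincidence`: resolve the coincidence `m ≡ n`. The elements put on the queue are distinct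
rows, so `ω` rounds always empty it (`resolve_queue_eq_nil` below). -/
def Table.coincidence (T : Table R) (m n : ℕ) : Table R :=
  (resolve T.ω (merge T [] m n)).1

/-- The constraints on an enumeration table that the fields do not express: the entries are rows,
and `ρ` maps rows to rows and does not increase. -/
structure Table.Valid (T : Table R) : Prop where
  entry : ∀ i y j, T.A i y = some j → 1 ≤ j ∧ j ≤ T.ω
  rho_le : ∀ i, T.ρ i ≤ i
  rho_pos : ∀ i, 1 ≤ i → 1 ≤ T.ρ i

theorem rep_spec (ρ : ℕ → ℕ) (h1 : ∀ i, ρ i ≤ i) (h2 : ∀ i, 1 ≤ i → 1 ≤ ρ i) (i : ℕ) :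
    ρ (rep ρ i) = rep ρ i ∧ rep ρ i ≤ i ∧ (1 ≤ i → 1 ≤ rep ρ i) := by
  induction i using Nat.strong_induction_on with
  | _ i ih =>
    rw [rep]
    split
    · next h =>
      obtain ⟨a, b, c⟩ := ih _ h
      exact ⟨a, b.trans h.le, fun hi => c (h2 i hi)⟩
    · next h => exact ⟨by have := h1 i; omega, le_rfl, id⟩

theorem updateLoop_spec (ε : ℕ) (hε : 1 ≤ ε) (n : ℕ) (ρ : ℕ → ℕ) (h1 : ∀ i, ρ i ≤ i)
    (h2 : ∀ i, 1 ≤ i → 1 ≤ ρ i) (hn : ε = rep ρ n) :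
    (∀ i, updateLoop ε ρ n i ≤ i) ∧ (∀ i, 1 ≤ i → 1 ≤ updateLoop ε ρ n i) ∧
      ∀ i, updateLoop ε ρ n i = i ↔ ρ i = i := by
  induction n using Nat.strong_induction_on generalizing ρ with
  | _ n ih =>
    rw [updateLoop]
    split
    · next h =>
      have hr : rep ρ n = rep ρ (ρ n) := by rw [rep, if_pos h]
      have hlt : ε < n := by
        have := (rep_spec ρ h1 h2 (ρ n)).2.1
        omega
      have key : ∀ m, m < n → rep (Function.update ρ n ε) m = rep ρ m := by
        intro m
        induction m using Nat.strong_induction_on with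
        | _ m ihm =>
          intro hm
          rw [rep, Function.update_of_ne (by omega), rep.eq_1 ρ m]
          split
          · next h' => exact ihm _ h' (by omega)
          · rfl
      obtain ⟨a, b, c⟩ := ih (ρ n) h (Function.update ρ n ε)
        (by
          intro i
          by_cases hi : i = n
          · subst hi; simp; omega
          · simpa [hi] using h1 i)
        (by
          intro i hi'
          by_cases hi : i = n
          · subst hi; simpa using hε
          · simpa [hi] using h2 i hi')
        (by rw [key _ h, hn, hr])
      refine ⟨a, b, fun i => (c i).trans ?_⟩
      by_cases hi : i = n
      · subst hi; simp; omega
      · simp [hi]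
    · exact ⟨h1, h2, fun i => Iff.rfl⟩

theorem Table.Valid.update {T : Table R} (hT : T.Valid) (i : ℕ) (hi : 1 ≤ i) :
    (T.update i).Valid ∧ (T.update i).live = T.live := by
  have h := updateLoop_spec (rep T.ρ i) ((rep_spec T.ρ hT.rho_le hT.rho_pos i).2.2 hi) i T.ρ
    hT.rho_le hT.rho_pos rfl
  refine ⟨⟨hT.entry, h.1, h.2.1⟩, ?_⟩
  ext j
  simp only [Table.live, Finset.mem_filter]
  exact and_congr_right fun _ => h.2.2 j

/-- All elements of the queue are rows, and they are at most `n` together with the live rows. -/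
def QueueInv (n ω : ℕ) (s : Table R × List ℕ) : Prop :=
  s.1.Valid ∧ s.1.ω = ω ∧ (∀ d ∈ s.2, 1 ≤ d ∧ d ≤ ω) ∧ s.2.length + s.1.live.card ≤ n

theorem merge_inv {n ω : ℕ} {T : Table R} {Q : List ℕ} (h : QueueInv n ω (T, Q)) {i j : ℕ}
    (hi : 1 ≤ i ∧ i ≤ ω) (hj : 1 ≤ j ∧ j ≤ ω) : QueueInv n ω (merge T Q i j) := by
  obtain ⟨hT, hω, hQ, hc⟩ := h
  simp only at hT hω hQ hc
  obtain ⟨a1, b1, c1⟩ := rep_spec T.ρ hT.rho_le hT.rho_pos i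
  obtain ⟨a2, b2, c2⟩ := rep_spec T.ρ hT.rho_le hT.rho_pos j
  replace c1 := c1 hi.1
  replace c2 := c2 hj.1
  simp only [merge]
  generalize rep T.ρ i = μ at *
  generalize rep T.ρ j = ν at *
  split
  · next hne =>
    have hM : 1 ≤ max μ ν ∧ max μ ν ≤ ω ∧ T.ρ (max μ ν) = max μ ν ∧ min μ ν < max μ ν ∧
        1 ≤ min μ ν := by
      rcases lt_or_gt_of_ne hne with h | h
      · rw [max_eq_right h.le, min_eq_left h.le]
        exact ⟨c2, by omega, a2, h, c1⟩
      · rw [max_eq_left h.le, min_eq_right h.le]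
        exact ⟨c1, by omega, a1, h, c2⟩
    generalize max μ ν = M at *
    generalize min μ ν = m at *
    obtain ⟨m1, m2, m3, m4, m5⟩ := hM
    refine ⟨⟨hT.entry, fun k => ?_, fun k hk => ?_⟩, hω, ?_, ?_⟩
    · by_cases hkM : k = M
      · subst hkM; simpa using m4.le
      · simpa [hkM] using hT.rho_le k
    · by_cases hkM : k = M
      · subst hkM; simpa using m5
      · simpa [hkM] using hT.rho_pos k hk
    · intro d hd
      rcases List.mem_append.1 hd with hd | hd
      · exact hQ d hd
      · rw [List.mem_singleton.1 hd]; exact ⟨m1, m2⟩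
    · have hlt : Finset.card (Table.live { T with ρ := Function.update T.ρ M m }) <
          T.live.card := by
        apply Finset.card_lt_card
        rw [Finset.ssubset_iff_of_subset]
        · refine ⟨M, ?_, ?_⟩
          · simp [Table.live, m1, m3, hω, m2]
          · simp [Table.live]; omega
        · intro k hk
          simp only [Table.live, Finset.mem_filter] at hk ⊢
          refine ⟨hk.1, ?_⟩
          by_cases hkM : k = M
          · rw [hkM]; exact m3
          · simpa [hkM] using hk.2
      simp only [List.length_append, List.length_singleton]
      omega
  · exact ⟨hT, hω, hQ, hc⟩

theorem relocate_inv {n ω d : ℕ} (hd : 1 ≤ d ∧ d ≤ ω) {s : Table R × List ℕ}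
    (h : QueueInv n ω s) (x : Letter g) : QueueInv n ω (relocate d s x) := by
  obtain ⟨T, Q⟩ := s
  obtain ⟨hT, hω, hQ, hc⟩ := h
  simp only at hT hω hQ hc
  simp only [relocate]
  split
  · exact ⟨hT, hω, hQ, hc⟩
  · next e he =>
    have he' := hT.entry _ _ _ he
    have hT1 : (T.removePair d x e).Valid := by
      refine ⟨fun i y j hij => ?_, hT.rho_le, hT.rho_pos⟩
      simp only [Table.removePair, setEntry] at hij
      split at hij
      · simp at hij
      · split at hij
        · simp at hij
        · exact hT.entry i y j hij
    have hl1 : (T.removePair d x e).live = T.live := rfl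
    have hw1 : (T.removePair d x e).ω = ω := hω
    generalize T.removePair d x e = T₁ at *
    obtain ⟨hT2, hl2⟩ := hT1.update d hd.1
    have hδ := (rep_spec T₁.ρ hT1.rho_le hT1.rho_pos d).2
    have hw2 : (T₁.update d).ω = ω := hw1
    generalize rep T₁.ρ d = δ at *
    generalize T₁.update d = T₂ at *
    obtain ⟨hT3, hl3⟩ := hT2.update e he'.1
    have hε := (rep_spec T₂.ρ hT2.rho_le hT2.rho_pos e).2
    have hw3 : (T₂.update e).ω = ω := hw2
    generalize rep T₂.ρ e = ε at *
    generalize T₂.update e = T₃ at *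
    have hδ' : 1 ≤ δ ∧ δ ≤ ω := ⟨hδ.2 hd.1, hδ.1.trans hd.2⟩
    have hε' : 1 ≤ ε ∧ ε ≤ ω := ⟨hε.2 he'.1, hε.1.trans (hω ▸ he'.2)⟩
    have hinv : QueueInv n ω (T₃, Q) := ⟨hT3, hw3, hQ, by
      simp only [hl3, hl2, hl1]; exact hc⟩
    split
    · next f hf => exact merge_inv hinv hε' (hw3 ▸ hT3.entry _ _ _ hf)
    · split
      · next f hf => exact merge_inv hinv hδ' (hw3 ▸ hT3.entry _ _ _ hf)
      · refine ⟨⟨fun i y j hij => ?_, hT3.rho_le, hT3.rho_pos⟩, hw3, hQ, hinv.2.2.2⟩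
        change 1 ≤ j ∧ j ≤ T₃.ω
        rw [hw3]
        simp only [Table.addPair, setEntry] at hij
        split at hij
        · simp only [Option.some.injEq] at hij; omega
        · split at hij
          · simp only [Option.some.injEq] at hij; omega
          · exact hw3 ▸ hT3.entry i y j hij

theorem resolve_inv (n ω : ℕ) (s : Table R × List ℕ) (h : QueueInv n ω s) :
    (resolve n s).2 = [] := by
  induction n generalizing s with
  | zero =>
    obtain ⟨T, Q⟩ := s
    have := h.2.2.2
    simp only [resolve]
    exact List.length_eq_zero_iff.1 (by simp only at this; omega)
  | succ n ih =>
    obtain ⟨T, Q⟩ := s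
    cases Q with
    | nil => rfl
    | cons d Q =>
      simp only [resolve]
      apply ih
      obtain ⟨hT, hω, hQ, hc⟩ := h
      simp only [List.length_cons, List.mem_cons, forall_eq_or_imp] at hT hω hQ hc
      have h0 : QueueInv n ω (T, Q) := ⟨hT, hω, hQ.2, by simp only; omega⟩
      generalize (T, Q) = s at h0
      induction letters g generalizing s with
      | nil => exact h0
      | cons x l ihl => exact ihl _ (relocate_inv hQ.1 h0 x)

/-- The bound on the number of rounds in `Table.coincidence` is never the reason for stopping. -/
theorem resolve_queue_eq_nil (T : Table R) (hT : T.Valid) (m n : ℕ) (hm : 1 ≤ m ∧ m ≤ T.ω)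
    (hn : 1 ≤ n ∧ n ≤ T.ω) : (resolve T.ω (merge T [] m n)).2 = [] := by
  refine resolve_inv _ T.ω _ (merge_inv ⟨hT, rfl, by simp, ?_⟩ hm hn)
  have : T.live.card ≤ (Finset.Icc 1 T.ω).card := Finset.card_filter_le _ _
  simpa using this

/-- Scan the word from `k` as far as entries are defined: the row that is reached, and the part of
the word that is left. -/
def Table.forward (T : Table R) : ℕ → List (Letter g) → ℕ × List (Letter g)
  | k, [] => (k, [])
  | k, y :: v =>
    match T.A k y with
    | some k' => T.forward k' v
    | none => (k, y :: v)

/-- Scan the word backward from `l`: the row that is reached, and the part of the word that is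
left. -/
def Table.backward (T : Table R) (l : ℕ) (v : List (Letter g)) : ℕ × List (Letter g) :=
  let r := T.forward l (v.reverse.map Letter.bar)
  (r.1, r.2.reverse.map Letter.bar)

theorem Table.forward_measure (T : Table R) (k : ℕ) (v : List (Letter g)) :
    2 * (T.forward k v).2.length + 1 ≤
      2 * v.length + (match v with | [] => 1 | y :: _ => if (T.A k y).isSome then 0 else 1) := by
  induction v generalizing k with
  | nil => simp [Table.forward]
  | cons y v ih =>
    rw [Table.forward]
    cases h : T.A k y with
    | none => simp [h]
    | some k' =>
      have := ih k'
      simp only [h, List.length_cons, Option.isSome_some, if_true]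
      split at this
      · simp_all
      · split at this <;> simp_all <;> omega

theorem Table.forward_length_le (T : Table R) (k : ℕ) (v : List (Letter g)) :
    (T.forward k v).2.length ≤ v.length := by
  induction v generalizing k with
  | nil => simp [Table.forward]
  | cons y v ih =>
    rw [Table.forward]
    cases h : T.A k y with
    | none => simp
    | some k' => exact (ih k').trans (by simp)

theorem Table.backward_length_le (T : Table R) (l : ℕ) (v : List (Letter g)) :
    (T.backward l v).2.length ≤ v.length := by
  simpa [Table.backward] using T.forward_length_le l (v.reverse.map Letter.bar)

theorem Table.define_A_isSome (T : Table R) (i : ℕ) (y : Letter g) :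
    ((T.define i y).A i y).isSome = true := by
  simp only [Table.define, setEntry]
  split <;> simp

/-- The main loop of `Scan`. The word `v` is the part `y_f … y_b` that has not been scanned yet,
so that `f ≤ b` means `v ≠ []`, and `f = b` means that `v` has exactly one letter. -/
def Table.scanLoop (T : Table R) (k l : ℕ) (v : List (Letter g)) : Table R :=
  if v = [] then T
  else
    match h : (T.backward l (T.forward k v).2).2 with
    | [] =>
      if (T.forward k v).1 ≠ (T.backward l (T.forward k v).2).1 then
        T.coincidence (T.forward k v).1 (T.backward l (T.forward k v).2).1
      else T
    | [y] => T.deduction (T.forward k v).1 y (T.backward l (T.forward k v).2).1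
    | y :: y' :: v' =>
      (T.define (T.forward k v).1 y).scanLoop (T.forward k v).1
        (T.backward l (T.forward k v).2).1 (y :: y' :: v')
termination_by 2 * v.length + (match v with | [] => 1 | y :: _ => if (T.A k y).isSome then 0 else 1)
decreasing_by
  have h1 := T.forward_measure k v
  have h2 := T.backward_length_le l (T.forward k v).2
  rw [h] at h2
  simp only [Table.define_A_isSome, if_true]
  omega

/-- `Scan`: scan the relation `i ^ w = j`. -/
def Table.scan (T : Table R) (i : ℕ) (w : List (Letter g)) (j : ℕ) : Table R :=
  T.scanLoop i j w

/-! ### The enumeration process -/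

/-- Scan all primary relations. -/
def Table.scanPrimary (T : Table R) (rels : List (Relation g)) : Table R :=
  rels.foldl (fun T r =>
    T.scan (rep T.ρ ((r.lhs : ℕ) + 1)) r.word.toWord (rep T.ρ ((r.rhs : ℕ) + 1))) T

/-- Scan the secondary words for row `i`, stopping as soon as `i` is dead. -/
def Table.scanSecondary (T : Table R) (i : ℕ) : List (List (Letter g)) → Table R
  | [] => T
  | w :: ws => if i ∈ T.live then (T.scan i w i).scanSecondary i ws else T

/-- Ward's modification: if row `i` is live, fill its undefined entries. -/
def Table.fillRow (T : Table R) (i : ℕ) : Table R :=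
  if i ∈ T.live then
    (letters g).foldl (fun T y => if (T.A i y).isSome then T else T.define i y) T
  else T

/-- One round of the main loop. The flag says whether Ward's modification is executed. -/
def Table.round (ward : Bool) (T : Table R) (i : ℕ) : Table R :=
  let T' := T.scanSecondary i (secondaryWords R)
  if ward then T'.fillRow i else T'

/-- The main loop with run limit `M`, returning the final table and counter. -/
def mainLoop (ward : Bool) (M : ℕ) (T : Table R) (i : ℕ) : Table R × ℕ :=
  if i ≤ T.maxLive ∧ i ≤ M then mainLoop ward M (T.round ward i) (i + 1) else (T, i)
termination_by M + 1 - i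

/-- The result of a run, together with the final table. -/
inductive Outcome (R : List (Relation g)) where
  | completed (T : Table R)
  | runLimitExceeded (T : Table R)

/-- The enumeration process, with Ward's modification (`ward = true`) or without it. -/
def process (ward : Bool) (R : List (Relation g)) (M : ℕ) : Outcome R :=
  let s := mainLoop ward M ((initTable R).scanPrimary R) 1
  if s.1.maxLive < s.2 then Outcome.completed s.1 else Outcome.runLimitExceeded s.1

/-- The full rack enumeration procedure. -/
def Enumerate (R : List (Relation g)) (M : ℕ) : Outcome R := process true R M

/-- The rack enumeration procedure with Ward's modification omitted. -/
def W (R : List (Relation g)) (M : ℕ) : Outcome R := process false R M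

/-- The run completes: it ends because all live rows have been treated. -/
def Outcome.Completes (o : Outcome R) : Prop := ∃ T, o = Outcome.completed T

/-- The relations `a ^ a = a`, `b ^ b = b`, `a ^ (b a b a b̄) = a`, `b ^ (b a b a b̄) = b`,
with `a = x_1` and `b = x_2`. -/
def wardExample : List (Relation 2) :=
  let a : FreeGroup (Fin 2) := FreeGroup.of 0
  let b : FreeGroup (Fin 2) := FreeGroup.of 1
  [⟨0, a, 0⟩, ⟨1, b, 1⟩, ⟨0, b * a * b * a * b⁻¹, 0⟩, ⟨1, b * a * b * a * b⁻¹, 1⟩]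

end RackEnum

namespace RackEnum

/-! ### Finiteness of the presented rack -/

/-! Finiteness. The last two relations say that the inner automorphism given by `b a b a b̄` fixes
both generators, so it commutes with the permutations `α`, `β` by which `a` and `b` act. In a group
this forces `α β = β α` (`Perm.commute_of_relations`). The relations then reduce to "`b` fixes `a`"
and "`a²` fixes `b`", and `{a, b, a ◃ b}` is closed under both actions and their inverses.

Non-completion. The collapse needs `b` to be invertible everywhere, and without Ward's modification
nothing forces entries at `b̄`. The partial action `ptAction` exploits this: `a` and `b` act by
total injective maps, `b` is not onto, and `x^{baba} = x^b` for every `x`. Each secondary word then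
labels a fully defined closed path at every point, and each primary relation holds at the points
chosen for the generators. Hence every table in the run maps to `ptAction` (`Table.Interp`,
`Table.MapsToPt`): a new row is sent to the next point of the scanned path, deductions are true
there, and coincidences only identify rows with equal image.

The first nonempty secondary word begins with `b`, so each treated row acquires an entry at `b`, and
its class keeps one through later coincidences (`scanLoop_spec`, `Table.Extends`, `mainLoop_spec`).
If a run completed, the images of the finitely many live rows would contain the image of `a` and be
closed under `b`. The orbit of that point under `b` is infinite (`Pt.mapB_iterate_base`), a
contradiction. -/

theorem PresentedRack.mk_mul_of {g : ℕ} (R : List (Relation g)) (i k : Fin g)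
    (u : FreeGroup (Fin g)) :
    (Quotient.mk (congrSetoid R) ⟨i, u * FreeGroup.of k⟩ : PresentedRack R) =
      PresentedRack.gen R k ◃ (Quotient.mk (congrSetoid R) ⟨i, u⟩ : PresentedRack R) := by
  refine congrArg (Quotient.mk (congrSetoid R)) (FreeRack.ext rfl ?_)
  change _ = u * 1⁻¹ * FreeGroup.of k * 1
  simp

theorem PresentedRack.mk_mul_of_inv {g : ℕ} (R : List (Relation g)) (i k : Fin g)
    (u : FreeGroup (Fin g)) :
    (Quotient.mk (congrSetoid R) ⟨i, u * (FreeGroup.of k)⁻¹⟩ : PresentedRack R) =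
      PresentedRack.gen R k ◃⁻¹ (Quotient.mk (congrSetoid R) ⟨i, u⟩ : PresentedRack R) := by
  refine congrArg (Quotient.mk (congrSetoid R)) (FreeRack.ext rfl ?_)
  change _ = u * 1⁻¹ * (FreeGroup.of k)⁻¹ * 1
  simp

theorem PresentedRack.mk_eq_gen {g : ℕ} {R : List (Relation g)} {r : Relation g} (hr : r ∈ R) :
    (Quotient.mk (congrSetoid R) ⟨r.lhs, r.word⟩ : PresentedRack R) =
      PresentedRack.gen R r.rhs :=
  Quotient.sound (s := congrSetoid R) (Congr.rel r hr)

/-- A set of elements that contains the generators and is stable under their actions is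
everything. -/
theorem PresentedRack.induction_on {g : ℕ} {R : List (Relation g)} {P : PresentedRack R → Prop}
    (hgen : ∀ i, P (PresentedRack.gen R i)) (hact : ∀ i q, P q → P (PresentedRack.gen R i ◃ q))
    (hinv : ∀ i q, P q → P (PresentedRack.gen R i ◃⁻¹ q)) (q : PresentedRack R) : P q := by
  obtain ⟨i, u⟩ := q
  have key : ∀ (v u : FreeGroup (Fin g)), P (Quotient.mk (congrSetoid R) ⟨i, u⟩) →
      P (Quotient.mk (congrSetoid R) ⟨i, u * v⟩) := by
    intro v
    induction v using FreeGroup.induction_on with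
    | C1 => intro u h; simpa using h
    | of k => intro u h; rw [mk_mul_of]; exact hact _ _ h
    | inv_of k _ => intro u h; rw [mk_mul_of_inv]; exact hinv _ _ h
    | mul x y hx hy => intro u h; rw [← mul_assoc]; exact hy _ (hx _ h)
  have := key u 1 (hgen i)
  rwa [one_mul] at this

/-- Write `γ = β⁻¹αβαβ`. Commuting with `β` gives `αβαβ = βαβα`, which turns `γ` into `αβα`;
commuting with `α` then cancels down to `βα = αβ`. -/
theorem Perm.commute_of_relations {G : Type*} [Group G] {α β : G}
    (h1 : (β⁻¹ * α * β * α * β) * α = α * (β⁻¹ * α * β * α * β))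
    (h2 : (β⁻¹ * α * β * α * β) * β = β * (β⁻¹ * α * β * α * β)) : α * β = β * α := by
  have e : β⁻¹ * α * β * α * β = α * β * α := by
    have h3 : α * β * α * β * β = β * α * β * α * β := by
      have := congrArg (β * ·) h2
      simpa [mul_assoc] using this
    have h4 : α * β * α * β = β * α * β * α := mul_right_cancel h3
    calc β⁻¹ * α * β * α * β = β⁻¹ * (α * β * α * β) := by group
      _ = α * β * α := by rw [h4]; group
  rw [e] at h1
  have h5 : α * ((β * α) * α) = α * ((α * β) * α) := by simpa [mul_assoc] using h1
  exact (mul_right_cancel (mul_left_cancel h5)).symm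

theorem finite_wardExample : Finite (PresentedRack wardExample) := by
  set a : PresentedRack wardExample := PresentedRack.gen wardExample 0 with ha
  set b : PresentedRack wardExample := PresentedRack.gen wardExample 1 with hb
  have word : ∀ i : Fin 2, (Quotient.mk (congrSetoid wardExample)
      ⟨i, FreeGroup.of 1 * FreeGroup.of 0 * FreeGroup.of 1 * FreeGroup.of 0 *
        (FreeGroup.of 1)⁻¹⟩ : PresentedRack wardExample) =
      b ◃⁻¹ (a ◃ (b ◃ (a ◃ (b ◃ PresentedRack.gen wardExample i)))) := by
    intro i
    rw [PresentedRack.mk_mul_of_inv, PresentedRack.mk_mul_of, PresentedRack.mk_mul_of,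
      PresentedRack.mk_mul_of, ← one_mul (FreeGroup.of 1), PresentedRack.mk_mul_of]
    rfl
  have r1 : a ◃ a = a := by
    have := PresentedRack.mk_eq_gen (R := wardExample) (r := ⟨0, FreeGroup.of 0, 0⟩)
      (by simp [wardExample])
    rw [← one_mul (FreeGroup.of 0), PresentedRack.mk_mul_of] at this
    exact this
  have r2 : b ◃ b = b := by
    have := PresentedRack.mk_eq_gen (R := wardExample) (r := ⟨1, FreeGroup.of 1, 1⟩)
      (by simp [wardExample])
    rw [← one_mul (FreeGroup.of 1), PresentedRack.mk_mul_of] at this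
    exact this
  have r3 : b ◃⁻¹ (a ◃ (b ◃ (a ◃ (b ◃ a)))) = a :=
    (word 0).symm.trans (PresentedRack.mk_eq_gen (R := wardExample)
      (r := ⟨0, FreeGroup.of 1 * FreeGroup.of 0 * FreeGroup.of 1 * FreeGroup.of 0 *
        (FreeGroup.of 1)⁻¹, 0⟩) (by simp [wardExample]))
  have r4 : b ◃⁻¹ (a ◃ (b ◃ (a ◃ (b ◃ b)))) = b :=
    (word 1).symm.trans (PresentedRack.mk_eq_gen (R := wardExample)
      (r := ⟨1, FreeGroup.of 1 * FreeGroup.of 0 * FreeGroup.of 1 * FreeGroup.of 0 *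
        (FreeGroup.of 1)⁻¹, 1⟩) (by simp [wardExample]))
  -- Inner maps and their inverses are automorphisms by self-distributivity. With `r3` and `r4`, an
  -- automorphism fixing a generator commutes with the action of that generator.
  have auto : ∀ x y : PresentedRack wardExample,
      b ◃⁻¹ (a ◃ (b ◃ (a ◃ (b ◃ (x ◃ y))))) =
        (b ◃⁻¹ (a ◃ (b ◃ (a ◃ (b ◃ x))))) ◃ (b ◃⁻¹ (a ◃ (b ◃ (a ◃ (b ◃ y))))) := by
    intro x y
    have hinv : ∀ x y, b ◃⁻¹ (x ◃ y) = (b ◃⁻¹ x) ◃ (b ◃⁻¹ y) := fun x y => by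
      rw [← Rack.left_cancel b, Shelf.self_distrib, Rack.right_inv, Rack.right_inv,
        Rack.right_inv]
    have hd : ∀ c x y : PresentedRack wardExample, c ◃ (x ◃ y) = (c ◃ x) ◃ (c ◃ y) :=
      fun c x y => Shelf.self_distrib
    rw [hd b x, hd a (b ◃ x), hd b (a ◃ (b ◃ x)), hd a (b ◃ (a ◃ (b ◃ x))), hinv]
  let α : Equiv.Perm (PresentedRack wardExample) := Rack.act' a
  let β : Equiv.Perm (PresentedRack wardExample) := Rack.act' b
  have comm : α * β = β * α := by
    refine Perm.commute_of_relations (Equiv.ext fun y => ?_) (Equiv.ext fun y => ?_)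
    · exact (auto a y).trans (by rw [r3]; rfl)
    · exact (auto b y).trans (by rw [r4]; rfl)
  have ab : ∀ y, a ◃ (b ◃ y) = b ◃ (a ◃ y) := fun y => DFunLike.congr_fun comm y
  -- Once the two actions commute, `b` cancels against its inverse in `r3` and `r4`; idempotence of
  -- the generators removes the rest.
  have r5 : b ◃ a = a := by
    have h := r3
    rw [ab (a ◃ (b ◃ a)), Rack.left_inv, ab a, r1, ab a, r1] at h
    exact h
  have r6 : a ◃ (a ◃ b) = b := by
    have h := r4
    rw [ab (a ◃ (b ◃ b)), Rack.left_inv, r2] at h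
    exact h
  have fin : ∀ q : PresentedRack wardExample, q ∈ ({a, b, a ◃ b} : Set _) := by
    refine PresentedRack.induction_on ?_ ?_ ?_
    · intro i; fin_cases i <;> simp [ha, hb]
    · intro i q hq
      rcases hq with rfl | rfl | rfl <;> fin_cases i
      · exact Or.inl r1
      · exact Or.inl r5
      · exact Or.inr (Or.inr rfl)
      · exact Or.inr (Or.inl r2)
      · exact Or.inr (Or.inl r6)
      · exact Or.inr (Or.inr ((ab b).symm.trans (by rw [r2])))
    · have inv : ∀ x y z : PresentedRack wardExample, x ◃ y = z → x ◃⁻¹ z = y := by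
        rintro x y _ rfl; exact Rack.left_inv x y
      intro i q hq
      rcases hq with rfl | rfl | rfl <;> fin_cases i
      · exact Or.inl (inv _ _ _ r1)
      · exact Or.inl (inv _ _ _ r5)
      · exact Or.inr (Or.inr (inv _ _ _ r6))
      · exact Or.inr (Or.inl (inv _ _ _ r2))
      · exact Or.inr (Or.inl (inv _ _ _ rfl))
      · exact Or.inr (Or.inr (inv _ _ _ ((ab b).symm.trans (by rw [r2]))))
  exact Set.finite_univ_iff.1 ((Set.toFinite {a, b, a ◃ b}).subset fun q _ => fin q)

/-! ### A partial action with an infinite forward orbit -/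

/-- A partial action of the letters, in which inverse letters act inversely. -/
structure PartialAction (g : ℕ) (X : Type*) where
  act : X → Letter g → Option X
  act_bar : ∀ {x y z}, act x y = some z → act z y.bar = some x

theorem Letter.bar_bar {g : ℕ} (y : Letter g) : y.bar.bar = y := by
  simp [Letter.bar]

theorem Letter.bar_ne {g : ℕ} (y : Letter g) : y.bar ≠ y := by
  intro h
  have := congrArg Prod.snd h
  simp [Letter.bar] at this

namespace PartialAction

variable {g : ℕ} {X : Type*}

/-- The end point of the path that starts at a point and is labelled by a word. -/
def run (P : PartialAction g X) : X → List (Letter g) → Option X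
  | x, [] => some x
  | x, y :: v => (P.act x y).bind fun z => P.run z v

theorem run_append (P : PartialAction g X) (x : X) (v w : List (Letter g)) :
    P.run x (v ++ w) = (P.run x v).bind fun z => P.run z w := by
  induction v generalizing x with
  | nil => simp [run]
  | cons y v ih =>
    simp only [List.cons_append, run, ih, Option.bind_assoc]

theorem run_reverse (P : PartialAction g X) {x z : X} {v : List (Letter g)}
    (h : P.run x v = some z) : P.run z (v.reverse.map Letter.bar) = some x := by
  induction v generalizing x with
  | nil => simpa [run, eq_comm] using h
  | cons y v ih =>
    simp only [run, Option.bind_eq_some_iff] at h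
    obtain ⟨t, ht, h⟩ := h
    rw [List.reverse_cons, List.map_append, run_append, ih h]
    simp [run, P.act_bar ht]

/-- The partial action given by injective maps and their partial inverses. -/
noncomputable def ofInjective (f : Fin g → X → X) (hf : ∀ i, Function.Injective (f i)) :
    PartialAction g X where
  act x y := if y.2 then some (f y.1 x) else Function.partialInv (f y.1) x
  act_bar {x y z} h := by
    have hp := fun i => (hf i).isPartialInv
    obtain ⟨i, _ | _⟩ := y
    · simpa [Letter.bar, hp i z x] using h
    · simpa [Letter.bar, hp i x z] using h

end PartialAction

/-- Two base points, and countably many lines. -/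
inductive Pt
  | fixed
  | base
  | line (i : ℕ) (n : ℤ)

/-- Fixes the base points and translates the lines by `-1`. -/
def Pt.mapA : Pt → Pt
  | fixed => fixed
  | base => base
  | line i n => line i (n - 1)

/-- Translates the right part of a line by `2`, and sends each point in its left part to a new
line. -/
def Pt.mapB : Pt → Pt
  | fixed => fixed
  | base => line 0 0
  | line i n => if -1 ≤ n then line i (n + 2) else line (Nat.pair i (-n).toNat + 1) 0

theorem Pt.mapA_injective : Function.Injective Pt.mapA := by
  rintro (_ | _ | ⟨i, n⟩) (_ | _ | ⟨j, m⟩) h <;> simp_all [mapA]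

/-- On each line the translated part `n ≥ -1` lands in positions `≥ 1`, which leaves position `0`
free. Line `0` uses it for the image of `base`; every other line is reserved, through the injective
pairing, for at most one left point. -/
theorem Pt.mapB_injective : Function.Injective Pt.mapB := by
  rintro (_ | _ | ⟨i, n⟩) (_ | _ | ⟨j, m⟩) h <;>
    simp only [mapB] at h <;> (try split_ifs at h) <;>
    simp only [line.injEq, Nat.add_right_cancel_iff, Nat.pair_eq_pair, reduceCtorEq,
      Nat.right_eq_add, Nat.add_eq_zero_iff, one_ne_zero, and_false, false_and] at h ⊢ <;>
    omega

/-- Every image of `mapB` on a line has position `m ≥ 0`, so `m - 1 ≥ -1` still lies in the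
translated part and goes to `m + 1`, which `a` brings back to `m`. This is why the threshold in
`mapB` is `-1` and the translation is by `2`. -/
theorem Pt.mapA_mapB_mapA_mapB (x : Pt) : x.mapB.mapA.mapB.mapA = x.mapB := by
  rcases x with _ | _ | ⟨i, n⟩
  · rfl
  · simp [mapA, mapB]
  · simp only [mapB]
    split_ifs with h
    · simp only [mapA]
      rw [if_pos (by omega)]
      simp only [line.injEq, true_and]
      omega
    · simp [mapA]

theorem Pt.mapB_iterate_base (n : ℕ) : Pt.mapB^[n + 1] Pt.base = Pt.line 0 (2 * n) := by
  induction n with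
  | zero => rfl
  | succ n ih =>
    rw [Function.iterate_succ_apply', ih, mapB, if_pos (by omega)]
    congr 1

/-- The partial action of `a` and `b` on `Pt`. -/
noncomputable def ptAction : PartialAction 2 Pt :=
  .ofInjective ![Pt.mapA, Pt.mapB] fun i => by
    fin_cases i
    · exact Pt.mapA_injective
    · exact Pt.mapB_injective

theorem ptAction_a (x : Pt) : ptAction.act x (0, true) = some x.mapA := rfl

theorem ptAction_b (x : Pt) : ptAction.act x (1, true) = some x.mapB := rfl

theorem ptAction_a_inv (x : Pt) : ptAction.act x.mapA (0, false) = some x :=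
  ptAction.act_bar (ptAction_a x)

theorem ptAction_b_inv (x : Pt) : ptAction.act x.mapB (1, false) = some x :=
  ptAction.act_bar (ptAction_b x)

/-- In this form the value is visibly an image of `mapB`, so the letter `b̄` that follows in the
secondary words is defined there. -/
theorem ptAction_mapB_a_inv (x : Pt) :
    ptAction.act x.mapB (0, false) = some x.mapB.mapA.mapB := by
  simpa only [Pt.mapA_mapB_mapA_mapB] using ptAction_a_inv x.mapB.mapA.mapB

/-- Both idempotence relations contribute the same empty word, whose scan has no effect. Both
remaining words begin with `b`. -/
theorem secondaryWords_wardExample : secondaryWords wardExample =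
    [[], [(1, true), (0, false), (1, false), (0, false), (1, false), (0, true), (1, true),
        (0, true), (1, true), (0, true), (1, false), (0, false)],
      [(1, true), (0, false), (1, false), (0, false), (1, true), (0, true), (1, true),
        (0, true), (1, false), (1, false)]] := by
  decide

theorem ptAction_run_secondaryWords {w : List (Letter 2)} (hw : w ∈ secondaryWords wardExample)
    (x : Pt) : ptAction.run x w = some x := by
  rw [secondaryWords_wardExample] at hw
  simp only [List.mem_cons, List.not_mem_nil, or_false] at hw
  rcases hw with rfl | rfl | rfl
  · rfl
  · simp [PartialAction.run, ptAction_a, ptAction_b, ptAction_a_inv, ptAction_b_inv,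
      ptAction_mapB_a_inv, Pt.mapA_mapB_mapA_mapB]
  · simp [PartialAction.run, ptAction_a, ptAction_b, ptAction_a_inv, ptAction_b_inv,
      ptAction_mapB_a_inv, Pt.mapA_mapB_mapA_mapB]

/-- The point that represents the generator `x_(i+1)`. -/
def genPt (i : Fin 2) : Pt := if i = 0 then Pt.base else Pt.fixed

theorem ptAction_run_wardExample {r : Relation 2} (hr : r ∈ wardExample) :
    ptAction.run (genPt r.lhs) r.word.toWord = some (genPt r.rhs) := by
  have h1 : (FreeGroup.of (0 : Fin 2)).toWord = [(0, true)] := by decide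
  have h2 : (FreeGroup.of (1 : Fin 2)).toWord = [(1, true)] := by decide
  have h3 : (FreeGroup.of (1 : Fin 2) * FreeGroup.of 0 * FreeGroup.of 1 * FreeGroup.of 0 *
      (FreeGroup.of 1)⁻¹).toWord =
        [(1, true), (0, true), (1, true), (0, true), (1, false)] := by decide
  simp only [wardExample, List.mem_cons, List.not_mem_nil, or_false] at hr
  rcases hr with rfl | rfl | rfl | rfl <;>
    simp only [h1, h2, h3, PartialAction.run, ptAction_a, ptAction_b, Option.bind_some,
      Pt.mapA_mapB_mapA_mapB, ptAction_b_inv] <;> rfl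

section Tables

variable {g : ℕ} {R : List (Relation g)} {X : Type*}

/-! ### Representatives -/

theorem rep_le (ρ : ℕ → ℕ) (i : ℕ) : rep ρ i ≤ i := by
  induction i using Nat.strong_induction_on with
  | _ i ih =>
    rw [rep]
    split
    · next h => exact (ih _ h).trans h.le
    · exact le_rfl

theorem rep_of_lt {ρ : ℕ → ℕ} {i : ℕ} (h : ρ i < i) : rep ρ i = rep ρ (ρ i) := by
  rw [rep, if_pos h]

theorem rep_of_le {ρ : ℕ → ℕ} {i : ℕ} (h : i ≤ ρ i) : rep ρ i = i := by
  rw [rep, if_neg (by omega)]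

theorem rep_lt_of_lt {ρ : ℕ → ℕ} {i : ℕ} (h : ρ i < i) : rep ρ i < i :=
  rep_of_lt h ▸ (rep_le ρ _).trans_lt h

theorem rep_rep (ρ : ℕ → ℕ) (i : ℕ) : rep ρ (rep ρ i) = rep ρ i := by
  induction i using Nat.strong_induction_on with
  | _ i ih =>
    rcases lt_or_ge (ρ i) i with h | h
    · rw [rep_of_lt h, ih _ h]
    · rw [rep_of_le h, rep_of_le h]

/-- `rep` is the only function constant along decreasing steps of `ρ` and equal to the identity
where `ρ` does not decrease. The effects of `Update`, `Merge` and `Define` on representatives are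
all read off from this. -/
theorem rep_eq_of_forall {ρ f : ℕ → ℕ} (h₁ : ∀ i, ρ i < i → f (ρ i) = f i)
    (h₂ : ∀ i, i ≤ ρ i → f i = i) (i : ℕ) : rep ρ i = f i := by
  induction i using Nat.strong_induction_on with
  | _ i ih =>
    rcases lt_or_ge (ρ i) i with h | h
    · rw [rep_of_lt h, ih _ h, h₁ _ h]
    · rw [rep_of_le h, h₂ _ h]

theorem rep_update_rep {ρ : ℕ → ℕ} {n : ℕ} (hn : ρ n < n) :
    rep (Function.update ρ n (rep ρ n)) = rep ρ := by
  refine funext (rep_eq_of_forall (fun i hi => ?_) (fun i hi => ?_))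
  · rcases eq_or_ne i n with rfl | hin
    · rw [Function.update_self, rep_rep]
    · rw [Function.update_of_ne hin] at hi ⊢
      exact (rep_of_lt hi).symm
  · rcases eq_or_ne i n with rfl | hin
    · rw [Function.update_self] at hi
      exact le_antisymm (rep_le _ _) hi
    · rw [Function.update_of_ne hin] at hi
      exact rep_of_le hi

/-- `Update` is path compression: it shortens chains and leaves the classes alone. -/
theorem rep_updateLoop (n : ℕ) (ρ : ℕ → ℕ) : rep (updateLoop (rep ρ n) ρ n) = rep ρ := by
  induction n using Nat.strong_induction_on generalizing ρ with
  | _ n ih =>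
    rw [updateLoop]
    split
    · next h =>
      have e := rep_update_rep h
      have := ih (ρ n) h (Function.update ρ n (rep ρ n))
      rwa [e, ← rep_of_lt h] at this
    · rfl

theorem rep_update_live {ρ : ℕ → ℕ} {M m : ℕ} (hM : rep ρ M = M) (hm : rep ρ m = m) (h : m < M)
    (i : ℕ) : rep (Function.update ρ M m) i = if rep ρ i = M then m else rep ρ i := by
  refine rep_eq_of_forall (f := fun i => if rep ρ i = M then m else rep ρ i)
    (fun i hi => ?_) (fun i hi => ?_) i
  · rcases eq_or_ne i M with rfl | hin
    · simp [hM, hm, h.ne]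
    · rw [Function.update_of_ne hin] at hi ⊢
      rw [rep_of_lt hi]
  · rcases eq_or_ne i M with rfl | hin
    · rw [Function.update_self] at hi
      omega
    · rw [Function.update_of_ne hin] at hi
      simp [rep_of_le hi, hin]

/-! ### Tables that map to a partial action -/

/-- A letter differs from its inverse, so the two slots written are distinct and the second write
never overrides the first, even for `i = j`. -/
theorem setEntry_pair_eq_some_iff {A : ℕ → Letter g → Option ℕ} {i j : ℕ} {y : Letter g}
    (h₁ : A i y = none) (h₂ : A j y.bar = none) (k : ℕ) (z : Letter g) (l : ℕ) :
    setEntry (setEntry A i y (some j)) j y.bar (some i) k z = some l ↔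
      (k = i ∧ z = y ∧ l = j) ∨ (k = j ∧ z = y.bar ∧ l = i) ∨ A k z = some l := by
  have hy := y.bar_ne
  simp only [setEntry]
  split_ifs with h h'
  · obtain ⟨rfl, rfl⟩ := h
    simp [hy, h₂, eq_comm]
  · obtain ⟨rfl, rfl⟩ := h'
    simp only [h₁, Option.some.injEq, true_and, reduceCtorEq, or_false, eq_comm]
    constructor
    · exact Or.inl
    · rintro (h' | h')
      · exact h'
      · exact absurd ⟨h'.1.symm, h'.2.1⟩ h
  · constructor
    · exact fun h => Or.inr (Or.inr h)
    · rintro (h'' | h'' | h'')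
      · exact absurd ⟨h''.1, h''.2.1⟩ h'
      · exact absurd ⟨h''.1, h''.2.1⟩ h
      · exact h''

theorem isSome_setEntry {A : ℕ → Letter g → Option ℕ} {i k : ℕ} {y z : Letter g} (j : ℕ)
    (h : (A k z).isSome) : (setEntry A i y (some j) k z).isSome := by
  simp only [setEntry]
  split_ifs
  · rfl
  · exact h

theorem setEntry_none_eq_some_iff {A : ℕ → Letter g → Option ℕ} {i j k l : ℕ} {y z : Letter g} :
    setEntry (setEntry A i y none) j y.bar none k z = some l ↔
      A k z = some l ∧ ¬(k = i ∧ z = y) ∧ ¬(k = j ∧ z = y.bar) := by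
  simp only [setEntry]
  split_ifs <;> simp_all

/-- The rows of `T` are mapped to points of a partial action, compatibly with the entries and the
coincidences; moreover the entries come in inverse pairs. -/
structure Table.Interp (T : Table R) (P : PartialAction g X) (φ : ℕ → X) : Prop where
  valid : T.Valid
  bar : ∀ {i y j}, T.A i y = some j → T.A j y.bar = some i
  act : ∀ {i y j}, T.A i y = some j → P.act (φ i) y = some (φ j)
  rep_of_lt : ∀ {i}, T.ω < i → rep T.ρ i = i
  map_rep : ∀ i, φ (rep T.ρ i) = φ i

/-- A row that represents its class. -/
structure Table.IsLive (T : Table R) (i : ℕ) : Prop where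
  pos : 1 ≤ i
  le : i ≤ T.ω
  rep_eq : rep T.ρ i = i

/-- Some row in the class of `i` has an entry at `y`. -/
def Table.Served (T : Table R) (y : Letter g) (i : ℕ) : Prop :=
  ∃ i', rep T.ρ i' = rep T.ρ i ∧ (T.A i' y).isSome

namespace Table.Interp

variable {T : Table R} {P : PartialAction g X} {φ : ℕ → X}

theorem row (h : T.Interp P φ) {i j : ℕ} {y : Letter g} (hij : T.A i y = some j) :
    1 ≤ i ∧ i ≤ T.ω :=
  h.valid.entry _ _ _ (h.bar hij)

theorem isLive_rep (h : T.Interp P φ) {i : ℕ} (h₁ : 1 ≤ i) (h₂ : i ≤ T.ω) :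
    T.IsLive (rep T.ρ i) :=
  ⟨(rep_spec T.ρ h.valid.rho_le h.valid.rho_pos i).2.2 h₁, (rep_le _ _).trans h₂, rep_rep _ _⟩

theorem addPair (h : T.Interp P φ) {i j : ℕ} {y : Letter g} (h₁ : T.A i y = none)
    (h₂ : T.A j y.bar = none) (hi : 1 ≤ i ∧ i ≤ T.ω) (hj : 1 ≤ j ∧ j ≤ T.ω)
    (ha : P.act (φ i) y = some (φ j)) : (T.addPair i y j).Interp P φ := by
  have key := setEntry_pair_eq_some_iff h₁ h₂
  refine ⟨⟨fun k z l hkl => ?_, h.valid.rho_le, h.valid.rho_pos⟩, fun {k z l} hkl => ?_,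
    fun {k z l} hkl => ?_, h.rep_of_lt, h.map_rep⟩
  · rcases (key k z l).1 hkl with ⟨_, _, rfl⟩ | ⟨_, _, rfl⟩ | h'
    · exact hj
    · exact hi
    · exact h.valid.entry _ _ _ h'
  · refine (key _ _ _).2 ?_
    rcases (key k z l).1 hkl with ⟨rfl, rfl, rfl⟩ | ⟨rfl, rfl, rfl⟩ | h'
    · exact Or.inr (Or.inl ⟨rfl, rfl, rfl⟩)
    · exact Or.inl ⟨rfl, y.bar_bar, rfl⟩
    · exact Or.inr (Or.inr (h.bar h'))
  · rcases (key k z l).1 hkl with ⟨rfl, rfl, rfl⟩ | ⟨rfl, rfl, rfl⟩ | h'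
    · exact ha
    · exact P.act_bar ha
    · exact h.act h'

theorem removePair (h : T.Interp P φ) {i j : ℕ} {y : Letter g} (hij : T.A i y = some j) :
    (T.removePair i y j).Interp P φ := by
  refine ⟨⟨fun k z l hkl => ?_, h.valid.rho_le, h.valid.rho_pos⟩, fun {k z l} hkl => ?_,
    fun {k z l} hkl => ?_, h.rep_of_lt, h.map_rep⟩
  · exact h.valid.entry _ _ _ (setEntry_none_eq_some_iff.1 hkl).1
  · obtain ⟨h', h₁, h₂⟩ := setEntry_none_eq_some_iff.1 hkl
    -- The reverse of a surviving entry cannot be one of the two removed slots: the entries of those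
    -- slots are reverse to each other, so the surviving entry would itself have been removed.
    refine setEntry_none_eq_some_iff.2 ⟨h.bar h', ?_, ?_⟩
    · rintro ⟨rfl, rfl⟩
      have := h.bar h'
      rw [hij, Option.some.injEq] at this
      exact h₂ ⟨this.symm, z.bar_bar.symm⟩
    · rintro ⟨rfl, hz⟩
      obtain rfl : z = y := by rw [← z.bar_bar, hz, y.bar_bar]
      have := h.bar h'
      rw [h.bar hij, Option.some.injEq] at this
      exact h₁ ⟨this.symm, rfl⟩
  · exact h.act (setEntry_none_eq_some_iff.1 hkl).1

theorem update (h : T.Interp P φ) {i : ℕ} (hi : 1 ≤ i) : (T.update i).Interp P φ where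
  valid := (h.valid.update i hi).1
  bar := h.bar
  act := h.act
  rep_of_lt hj := by
    simp only [Table.update, rep_updateLoop]
    exact h.rep_of_lt hj
  map_rep j := by
    simp only [Table.update, rep_updateLoop]
    exact h.map_rep j

/-- Indices beyond `ω` are their own representatives by the clause `rep_of_lt`, so turning `ω + 1`
into a row changes nothing. -/
theorem rep_define (h : T.Interp P φ) (i : ℕ) (y : Letter g) :
    rep (T.define i y).ρ = rep T.ρ := by
  refine funext (rep_eq_of_forall (fun j hj => ?_) (fun j hj => ?_))
  · rcases eq_or_ne j (T.ω + 1) with rfl | hjn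
    · simp [Table.define] at hj
    · simp only [Table.define, Function.update_of_ne hjn] at hj ⊢
      exact (RackEnum.rep_of_lt hj).symm
  · rcases eq_or_ne j (T.ω + 1) with rfl | hjn
    · exact h.rep_of_lt (Nat.lt_succ_self _)
    · simp only [Table.define, Function.update_of_ne hjn] at hj
      exact rep_of_le hj

theorem define (h : T.Interp P φ) {i : ℕ} {y : Letter g} {x : X} (hi : 1 ≤ i ∧ i ≤ T.ω)
    (h₁ : T.A i y = none) (hx : P.act (φ i) y = some x) :
    (T.define i y).Interp P (Function.update φ (T.ω + 1) x) := by
  have hrep := h.rep_define i y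
  simp only [Table.define] at hrep
  -- `T'` has the new row but not yet its entries; adding them is then an instance of `addPair`.
  let T' : Table R := ⟨T.ω + 1, T.A,
    Function.update T.τ (T.ω + 1) ((T.τ i).map (fun p => p.actLetter y)),
    Function.update T.ρ (T.ω + 1) (T.ω + 1)⟩
  have hT' : T'.Interp P (Function.update φ (T.ω + 1) x) := by
    refine ⟨⟨fun k z l hkl => ?_, fun k => ?_, fun k hk => ?_⟩, h.bar, fun {k z l} hkl => ?_,
      fun {k} hk => ?_, fun k => ?_⟩
    · have := h.valid.entry k z l hkl
      exact ⟨this.1, this.2.trans (Nat.le_succ _)⟩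
    · rcases eq_or_ne k (T.ω + 1) with rfl | hkn
      · exact (Function.update_self ..).le
      · exact (Function.update_of_ne hkn ..).le.trans (h.valid.rho_le k)
    · rcases eq_or_ne k (T.ω + 1) with rfl | hkn
      · simp [T']
      · exact (h.valid.rho_pos k hk).trans (Function.update_of_ne hkn ..).ge
    · have h1 := h.row hkl
      have h2 := h.valid.entry _ _ _ hkl
      rw [Function.update_of_ne (by omega), Function.update_of_ne (by omega)]
      exact h.act hkl
    · change rep (Function.update _ _ _) k = k
      rw [hrep]
      exact h.rep_of_lt (lt_trans (Nat.lt_succ_self _) hk)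
    · change Function.update φ (T.ω + 1) x (rep (Function.update _ _ _) k) = _
      rw [hrep]
      rcases lt_or_ge T.ω k with hk | hk
      · rw [h.rep_of_lt hk]
      · have := rep_le T.ρ k
        rw [Function.update_of_ne (by omega), Function.update_of_ne (by omega), h.map_rep]
  refine hT'.addPair (i := i) (j := T.ω + 1) (y := y) h₁ ?_ ⟨hi.1, hi.2.trans (Nat.le_succ _)⟩
    ⟨by omega, le_rfl⟩ ?_
  · rw [Option.eq_none_iff_forall_ne_some]
    intro l hl
    have := (h.row (i := T.ω + 1) hl).2
    omega
  · rw [Function.update_self, Function.update_of_ne (by omega)]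
    exact hx

end Table.Interp

/-! ### Coincidences -/

/-- Entries occur only in rows that are live or in the queue `Q`, and in row `d` at the letters
in `l`. -/
def Table.EntriesIn (T : Table R) (Q : List ℕ) (d : ℕ) (l : List (Letter g)) : Prop :=
  ∀ i y, (T.A i y).isSome → rep T.ρ i = i ∨ i ∈ Q ∨ (i = d ∧ y ∈ l)

variable {P : PartialAction g X} {φ : ℕ → X}

theorem merge_spec {T : Table R} (h : T.Interp P φ) {Q : List ℕ} {d : ℕ} {l : List (Letter g)}
    (he : T.EntriesIn Q d l) {m n : ℕ} (hm : 1 ≤ m ∧ m ≤ T.ω) (hn : 1 ≤ n ∧ n ≤ T.ω)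
    (hφ : φ m = φ n) :
    (merge T Q m n).1.Interp P φ ∧ (merge T Q m n).1.EntriesIn (merge T Q m n).2 d l ∧
      (merge T Q m n).1.ω = T.ω ∧ (merge T Q m n).1.A = T.A ∧
      rep (merge T Q m n).1.ρ m = rep (merge T Q m n).1.ρ n ∧
      ∀ i j, rep T.ρ i = rep T.ρ j → rep (merge T Q m n).1.ρ i = rep (merge T Q m n).1.ρ j := by
  have hμ := h.isLive_rep hm.1 hm.2
  have hν := h.isLive_rep hn.1 hn.2
  simp only [merge]
  split
  · next hne =>
    obtain ⟨M, m', hM, hm', hlt, hMl, hml, hφM, hor⟩ : ∃ M m', max (rep T.ρ m) (rep T.ρ n) = M ∧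
        min (rep T.ρ m) (rep T.ρ n) = m' ∧ m' < M ∧ T.IsLive M ∧ T.IsLive m' ∧ φ M = φ m' ∧
        (rep T.ρ m = M ∧ rep T.ρ n = m' ∨ rep T.ρ m = m' ∧ rep T.ρ n = M) := by
      have hφ' : φ (rep T.ρ m) = φ (rep T.ρ n) := by rw [h.map_rep, h.map_rep, hφ]
      rcases lt_or_gt_of_ne hne with hlt | hlt
      · exact ⟨_, _, max_eq_right hlt.le, min_eq_left hlt.le, hlt, hν, hμ, hφ'.symm,
          Or.inr ⟨rfl, rfl⟩⟩
      · exact ⟨_, _, max_eq_left hlt.le, min_eq_right hlt.le, hlt, hμ, hν, hφ', Or.inl ⟨rfl, rfl⟩⟩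
    rw [hM, hm']
    have hrep := rep_update_live hMl.rep_eq hml.rep_eq hlt
    refine ⟨⟨⟨h.valid.entry, fun i => ?_, fun i hi => ?_⟩, h.bar, h.act, fun {i} hi => ?_,
      fun i => ?_⟩, fun i y hi => ?_, rfl, rfl, ?_, fun i j hij => ?_⟩
    · rcases eq_or_ne i M with rfl | hiM
      · simpa using hlt.le
      · simpa [hiM] using h.valid.rho_le i
    · rcases eq_or_ne i M with rfl | hiM
      · simpa using hml.pos
      · simpa [hiM] using h.valid.rho_pos i hi
    · have : i ≠ M := by
        rintro rfl
        exact absurd hMl.le (not_le.2 hi)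
      simp only [hrep, h.rep_of_lt hi, this, if_false]
    · simp only [hrep]
      split
      · next hiM => rw [← hφM, ← hiM, h.map_rep]
      · exact h.map_rep i
    · simp only [hrep, List.mem_append, List.mem_singleton]
      rcases eq_or_ne i M with rfl | hiM
      · exact Or.inr (Or.inl (Or.inr rfl))
      · rcases he i y hi with h' | h' | h'
        · exact Or.inl (by rw [h', if_neg hiM])
        · exact Or.inr (Or.inl (Or.inl h'))
        · exact Or.inr (Or.inr h')
    · simp only [hrep]
      rcases hor with ⟨h1, h2⟩ | ⟨h1, h2⟩ <;> simp [h1, h2]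
    · simp only [hrep, hij]
  · next heq => exact ⟨h, he, rfl, rfl, not_not.1 heq, fun _ _ => id⟩

/-- The table `T'` has at least the rows of `T`, coincides them at least as much, and serves at
least the same classes. -/
structure Table.Extends (T' T : Table R) : Prop where
  omega_le : T.ω ≤ T'.ω
  rep_eq : ∀ i j, rep T.ρ i = rep T.ρ j → rep T'.ρ i = rep T'.ρ j
  served : ∀ y i, T.Served y i → T'.Served y i

theorem Table.Extends.refl (T : Table R) : T.Extends T :=
  ⟨le_rfl, fun _ _ => id, fun _ _ => id⟩

theorem Table.Extends.trans {T T' T'' : Table R} (h : T''.Extends T') (h' : T'.Extends T) :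
    T''.Extends T :=
  ⟨h'.omega_le.trans h.omega_le, fun _ _ hij => h.rep_eq _ _ (h'.rep_eq _ _ hij),
    fun _ _ hi => h.served _ _ (h'.served _ _ hi)⟩

theorem Table.Served.congr {T : Table R} {y : Letter g} {i j : ℕ} (h : T.Served y i)
    (hij : rep T.ρ i = rep T.ρ j) : T.Served y j := by
  obtain ⟨i', h1, h2⟩ := h
  exact ⟨i', h1.trans hij, h2⟩

/-- A served class stays served when entries are removed at `(d, x)` and `(e, x̄)` only, as long as
those two classes are still served. -/
theorem Table.Extends.of_removed {T T' : Table R} {d e : ℕ} {x : Letter g} (hω : T.ω ≤ T'.ω)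
    (hrep : ∀ i j, rep T.ρ i = rep T.ρ j → rep T'.ρ i = rep T'.ρ j)
    (hA : ∀ i y, (T.A i y).isSome → (T'.A i y).isSome ∨ (i = d ∧ y = x) ∨ (i = e ∧ y = x.bar))
    (hd : T'.Served x d) (he : T'.Served x.bar e) : T'.Extends T := by
  refine ⟨hω, hrep, ?_⟩
  rintro y i ⟨i', h1, h2⟩
  rcases hA _ _ h2 with h | ⟨rfl, rfl⟩ | ⟨rfl, rfl⟩
  · exact ⟨i', hrep _ _ h1, h⟩
  · exact hd.congr (hrep _ _ h1)
  · exact he.congr (hrep _ _ h1)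

/-- The removed arrow from `d` to `e` projects to an arrow between their representatives in `P`. It
is either re-entered there or absorbed by an existing arrow after a merge, so both end classes
remain served. -/
theorem relocate_spec {s : Table R × List ℕ} (h : s.1.Interp P φ) {d : ℕ} {x : Letter g}
    {l : List (Letter g)} (he : s.1.EntriesIn s.2 d (x :: l)) :
    (relocate d s x).1.Interp P φ ∧ (relocate d s x).1.EntriesIn (relocate d s x).2 d l ∧
      (relocate d s x).1.ω = s.1.ω ∧ (relocate d s x).1.Extends s.1 := by
  obtain ⟨T, Q⟩ := s
  simp only at h he
  simp only [relocate]
  split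
  · next hd =>
    refine ⟨h, fun i y hi => ?_, rfl, .refl _⟩
    rcases he i y hi with h' | h' | ⟨rfl, h'⟩
    · exact Or.inl h'
    · exact Or.inr (Or.inl h')
    · rcases List.mem_cons.1 h' with rfl | h'
      · simp [hd] at hi
      · exact Or.inr (Or.inr ⟨rfl, h'⟩)
  · next e hd =>
    have hdr := h.row hd
    have her := h.valid.entry _ _ _ hd
    have hda := h.act hd
    have h₃ := ((h.removePair hd).update hdr.1).update (i := e) her.1
    have hrep₂ : rep ((T.removePair d x e).update d).ρ = rep T.ρ := rep_updateLoop _ _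
    have hrep₃ : rep (((T.removePair d x e).update d).update e).ρ = rep T.ρ :=
      (rep_updateLoop _ _).trans hrep₂
    have hrep₁ : rep (T.removePair d x e).ρ = rep T.ρ := rfl
    have hω₃ : (((T.removePair d x e).update d).update e).ω = T.ω := rfl
    have hA₃ : ∀ i y j, (((T.removePair d x e).update d).update e).A i y = some j ↔
        T.A i y = some j ∧ ¬(i = d ∧ y = x) ∧ ¬(i = e ∧ y = x.bar) :=
      fun i y j => setEntry_none_eq_some_iff
    rw [hrep₁, hrep₂]
    generalize (((T.removePair d x e).update d).update e) = T₃ at *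
    have hδ := h.isLive_rep hdr.1 hdr.2
    have hε := h.isLive_rep her.1 her.2
    have hδε : P.act (φ (rep T.ρ d)) x = some (φ (rep T.ρ e)) := by
      rw [h.map_rep, h.map_rep, hda]
    have hδr : rep T.ρ (rep T.ρ d) = rep T.ρ d := hδ.rep_eq
    have hεr : rep T.ρ (rep T.ρ e) = rep T.ρ e := hε.rep_eq
    have hδ1 : 1 ≤ rep T.ρ d ∧ rep T.ρ d ≤ T₃.ω := ⟨hδ.pos, hω₃ ▸ hδ.le⟩
    have hε1 : 1 ≤ rep T.ρ e ∧ rep T.ρ e ≤ T₃.ω := ⟨hε.pos, hω₃ ▸ hε.le⟩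
    generalize hδd : rep T.ρ d = δ at *
    generalize hεe : rep T.ρ e = ε at *
    have hE₃ : T₃.EntriesIn Q d l := by
      intro i y hi
      obtain ⟨j, hj⟩ := Option.isSome_iff_exists.1 hi
      obtain ⟨h1, h2, -⟩ := (hA₃ _ _ _).1 hj
      rw [hrep₃]
      rcases he i y (by rw [h1]; rfl) with h' | h' | ⟨rfl, h'⟩
      · exact Or.inl h'
      · exact Or.inr (Or.inl h')
      · rcases List.mem_cons.1 h' with rfl | h'
        · exact absurd ⟨rfl, rfl⟩ h2
        · exact Or.inr (Or.inr ⟨rfl, h'⟩)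
    have hS₃ : ∀ i y, (T.A i y).isSome →
        (T₃.A i y).isSome ∨ (i = d ∧ y = x) ∨ (i = e ∧ y = x.bar) := by
      intro i y hi
      obtain ⟨j, hj⟩ := Option.isSome_iff_exists.1 hi
      by_cases h' : (i = d ∧ y = x) ∨ (i = e ∧ y = x.bar)
      · exact Or.inr h'
      · exact Or.inl (Option.isSome_iff_exists.2 ⟨j, (hA₃ _ _ _).2 ⟨hj, not_or.1 h'⟩⟩)
    have hR₃ : ∀ i j, rep T.ρ i = rep T.ρ j → rep T₃.ρ i = rep T₃.ρ j := by
      rw [hrep₃]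
      exact fun _ _ => id
    have hδ₃ : rep T₃.ρ δ = rep T₃.ρ d := hR₃ _ _ (hδr.trans hδd.symm)
    have hε₃ : rep T₃.ρ ε = rep T₃.ρ e := hR₃ _ _ (hεr.trans hεe.symm)
    split
    · next f hf =>
      -- Both points are the value of `P` at `φ δ` and `x`, so the merge respects `φ`.
      have hφ : φ ε = φ f := Option.some_injective _ (hδε.symm.trans (h₃.act hf))
      obtain ⟨m1, m2, m3, m4, m5, m6⟩ := merge_spec h₃ hE₃ hε1 (h₃.valid.entry _ _ _ hf) hφ
      refine ⟨m1, m2, m3.trans hω₃, .of_removed (m3.trans hω₃).ge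
        (fun i j hij => m6 i j (hR₃ i j hij)) (by rw [m4]; exact hS₃) ⟨δ, m6 _ _ hδ₃, ?_⟩
        ⟨f, m5.symm.trans (m6 _ _ hε₃), ?_⟩⟩
      · rw [m4, hf]; rfl
      · rw [m4, h₃.bar hf]; rfl
    · next hnone =>
      split
      · next f hf =>
        have hφ : φ δ = φ f := Option.some_injective _ ((P.act_bar hδε).symm.trans (h₃.act hf))
        obtain ⟨m1, m2, m3, m4, m5, m6⟩ := merge_spec h₃ hE₃ hδ1 (h₃.valid.entry _ _ _ hf) hφ
        refine ⟨m1, m2, m3.trans hω₃, .of_removed (m3.trans hω₃).ge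
          (fun i j hij => m6 i j (hR₃ i j hij)) (by rw [m4]; exact hS₃)
          ⟨f, m5.symm.trans (m6 _ _ hδ₃), ?_⟩ ⟨ε, m6 _ _ hε₃, ?_⟩⟩
        · have := h₃.bar hf
          rw [x.bar_bar] at this
          rw [m4, this]; rfl
        · rw [m4, hf]; rfl
      · next hnone' =>
        have key := setEntry_pair_eq_some_iff hnone hnone'
        refine ⟨h₃.addPair hnone hnone' hδ1 hε1 hδε, fun i y hi => ?_, hω₃, .of_removed hω₃.ge
          hR₃ (fun i y hi => (hS₃ i y hi).imp_left fun hi' => ?_) ⟨δ, hδ₃, ?_⟩ ⟨ε, hε₃, ?_⟩⟩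
        · obtain ⟨j, hj⟩ := Option.isSome_iff_exists.1 hi
          rcases (key _ _ _).1 hj with ⟨rfl, -, -⟩ | ⟨rfl, -, -⟩ | h'
          · exact Or.inl (by change rep T₃.ρ i = i; rw [hrep₃, hδr])
          · exact Or.inl (by change rep T₃.ρ i = i; rw [hrep₃, hεr])
          · exact hE₃ i y (by rw [h']; rfl)
        · obtain ⟨j, hj⟩ := Option.isSome_iff_exists.1 hi'
          exact Option.isSome_iff_exists.2 ⟨j, (key _ _ _).2 (Or.inr (Or.inr hj))⟩
        · exact Option.isSome_iff_exists.2 ⟨ε, (key _ _ _).2 (Or.inl ⟨rfl, rfl, rfl⟩)⟩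
        · exact Option.isSome_iff_exists.2 ⟨δ, (key _ _ _).2 (Or.inr (Or.inl ⟨rfl, rfl, rfl⟩))⟩

theorem foldl_relocate_spec (d : ℕ) (l : List (Letter g)) {s : Table R × List ℕ}
    (h : s.1.Interp P φ) (he : s.1.EntriesIn s.2 d l) :
    (l.foldl (relocate d) s).1.Interp P φ ∧
      (l.foldl (relocate d) s).1.EntriesIn (l.foldl (relocate d) s).2 d [] ∧
      (l.foldl (relocate d) s).1.ω = s.1.ω ∧ (l.foldl (relocate d) s).1.Extends s.1 := by
  induction l generalizing s with
  | nil => exact ⟨h, he, rfl, .refl _⟩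
  | cons x l ih =>
    obtain ⟨h1, h2, h3, h4⟩ := relocate_spec h he
    obtain ⟨i1, i2, i3, i4⟩ := ih h1 h2
    exact ⟨i1, i2, i3.trans h3, i4.trans h4⟩

theorem mem_letters (y : Letter g) : y ∈ letters g := by
  obtain ⟨i, _ | _⟩ := y <;> simp [letters]

/-- Between rounds no dead row is half processed, so `EntriesIn` is used with the dummy row `0` and
the empty list of letters. -/
theorem resolve_spec (n : ℕ) {s : Table R × List ℕ} (h : s.1.Interp P φ)
    (he : s.1.EntriesIn s.2 0 []) :
    (resolve n s).1.Interp P φ ∧ (resolve n s).1.EntriesIn (resolve n s).2 0 [] ∧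
      (resolve n s).1.ω = s.1.ω ∧ (resolve n s).1.Extends s.1 := by
  induction n generalizing s with
  | zero => exact ⟨h, he, rfl, .refl _⟩
  | succ n ih =>
    obtain ⟨T, _ | ⟨d, Q⟩⟩ := s
    · exact ⟨h, he, rfl, .refl _⟩
    · have he' : T.EntriesIn Q d (letters g) := by
        intro i y hi
        rcases he i y hi with h' | h' | h'
        · exact Or.inl h'
        · rcases List.mem_cons.1 h' with rfl | h'
          · exact Or.inr (Or.inr ⟨rfl, mem_letters y⟩)
          · exact Or.inr (Or.inl h')
        · exact absurd h'.2 List.not_mem_nil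
      obtain ⟨h1, h2, h3, h4⟩ := foldl_relocate_spec (s := (T, Q)) d (letters g) h he'
      obtain ⟨i1, i2, i3, i4⟩ := ih h1 fun i y hi => by simpa using h2 i y hi
      exact ⟨i1, i2, i3.trans h3, i4.trans h4⟩

/-- All entries are in live rows. -/
def Table.EntriesLive (T : Table R) : Prop :=
  ∀ {i y j}, T.A i y = some j → rep T.ρ i = i

theorem coincidence_spec {T : Table R} (h : T.Interp P φ) (he : T.EntriesLive) {m n : ℕ}
    (hm : 1 ≤ m ∧ m ≤ T.ω) (hn : 1 ≤ n ∧ n ≤ T.ω) (hφ : φ m = φ n) :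
    (T.coincidence m n).Interp P φ ∧ (T.coincidence m n).EntriesLive ∧
      rep (T.coincidence m n).ρ m = rep (T.coincidence m n).ρ n ∧
      (T.coincidence m n).Extends T := by
  have he' : T.EntriesIn [] 0 [] := fun i y hi => by
    obtain ⟨j, hj⟩ := Option.isSome_iff_exists.1 hi
    exact Or.inl (he hj)
  obtain ⟨m1, m2, m3, m4, m5, m6⟩ := merge_spec h he' hm hn hφ
  obtain ⟨r1, r2, r3, r4⟩ := resolve_spec T.ω m1 m2
  -- With the queue empty, only live rows can still carry entries.
  rw [resolve_queue_eq_nil T h.valid m n hm hn] at r2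
  refine ⟨r1, fun {i y j} hj => ?_, r4.rep_eq _ _ m5,
    r4.trans ⟨m3.ge, m6, fun y i ⟨i', h1, h2⟩ => ⟨i', m6 _ _ h1, by rwa [m4]⟩⟩⟩
  rcases r2 i y (by change ((T.coincidence m n).A i y).isSome; rw [hj]; rfl) with h' | h' | h'
  · exact h'
  · exact absurd h' List.not_mem_nil
  · exact absurd h'.2 List.not_mem_nil

/-! ### Scans -/

theorem Table.forward_spec {T : Table R} (h : T.Interp P φ) (he : T.EntriesLive)
    (v : List (Letter g)) {k : ℕ} (hk : T.IsLive k) :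
    T.IsLive (T.forward k v).1 ∧ (T.forward k v).2 <:+ v ∧
      P.run (φ k) v = P.run (φ (T.forward k v).1) (T.forward k v).2 ∧
      ∀ y u, (T.forward k v).2 = y :: u → T.A (T.forward k v).1 y = none := by
  induction v generalizing k with
  | nil => exact ⟨hk, List.suffix_rfl, rfl, by simp [Table.forward]⟩
  | cons y v ih =>
    rw [Table.forward]
    split
    · next k' hk' =>
      have hr := h.valid.entry _ _ _ hk'
      -- The row reached carries the reverse entry, hence it is live.
      obtain ⟨h1, h2, h3, h4⟩ := ih ⟨hr.1, hr.2, he (h.bar hk')⟩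
      refine ⟨h1, h2.trans (List.suffix_cons y v), ?_, h4⟩
      rw [← h3, PartialAction.run, h.act hk', Option.bind_some]
    · next hnone =>
      refine ⟨hk, List.suffix_rfl, rfl, ?_⟩
      rintro y' u ⟨⟩
      exact hnone

theorem Table.exists_entry_of_forward_eq_nil (T : Table R) (u : List (Letter g)) (y : Letter g)
    {k : ℕ} (h : (T.forward k (u ++ [y])).2 = []) :
    ∃ t, T.A t y = some (T.forward k (u ++ [y])).1 := by
  induction u generalizing k with
  | nil =>
    simp only [List.nil_append, Table.forward] at h ⊢
    split at h
    · next k' hk' => exact ⟨k, by simp [hk']⟩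
    · simp at h
  | cons x u ih =>
    simp only [List.cons_append, Table.forward] at h ⊢
    split at h
    · exact ih h
    · simp at h

theorem Table.backward_spec {T : Table R} (h : T.Interp P φ) (he : T.EntriesLive)
    (v : List (Letter g)) {l : ℕ} (hl : T.IsLive l) {x : X} (hx : P.run x v = some (φ l)) :
    T.IsLive (T.backward l v).1 ∧ (T.backward l v).2 <+: v ∧
      P.run x (T.backward l v).2 = some (φ (T.backward l v).1) ∧
      ∀ y, (T.backward l v).2 = [y] → T.A (T.backward l v).1 y.bar = none := by
  have hbar : ∀ u : List (Letter g), (u.reverse.map Letter.bar).reverse.map Letter.bar = u := by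
    intro u
    have : (Letter.bar ∘ Letter.bar : Letter g → Letter g) = id :=
      funext Letter.bar_bar
    simp [this]
  obtain ⟨h1, h2, h3, h4⟩ := Table.forward_spec h he (v.reverse.map Letter.bar) hl
  simp only [Table.backward]
  refine ⟨h1, ?_, ?_, fun y hy => h4 y.bar [] ?_⟩
  · obtain ⟨t, ht⟩ := h2
    refine ⟨t.reverse.map Letter.bar, ?_⟩
    rw [← List.map_append, ← List.reverse_append, ht, hbar]
  · refine P.run_reverse ?_
    rw [← h3]
    exact P.run_reverse hx
  · have := congrArg (fun u => u.reverse.map Letter.bar) hy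
    simpa only [hbar, List.reverse_cons, List.reverse_nil, List.nil_append, List.map_cons,
      List.map_nil] using this

/-- The last backward step uses `ȳ`; its reverse is an entry at `y` in the row where the scan ends.
-/
theorem Table.exists_entry_of_backward_eq_nil {T : Table R} (h : T.Interp P φ) {l : ℕ}
    {y : Letter g} {v : List (Letter g)} (hb : (T.backward l (y :: v)).2 = []) :
    (T.A (T.backward l (y :: v)).1 y).isSome := by
  simp only [Table.backward, List.reverse_cons, List.map_append, List.map_cons, List.map_nil,
    List.map_eq_nil_iff, List.reverse_eq_nil_iff] at hb ⊢
  obtain ⟨t, ht⟩ := T.exists_entry_of_forward_eq_nil _ _ hb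
  have := h.bar ht
  rw [y.bar_bar] at this
  rw [this]
  rfl

theorem Table.define_extends {T : Table R} (h : T.Interp P φ) (i : ℕ) (y : Letter g) :
    (T.define i y).Extends T := by
  have hrep := h.rep_define i y
  refine ⟨Nat.le_succ _, fun _ _ => by rw [hrep]; exact id, fun z k => ?_⟩
  rintro ⟨k', h1, h2⟩
  exact ⟨k', by rw [hrep, h1], isSome_setEntry _ (isSome_setEntry _ h2)⟩

theorem Table.addPair_extends (T : Table R) (i : ℕ) (y : Letter g) (j : ℕ) :
    (T.addPair i y j).Extends T :=
  ⟨le_rfl, fun _ _ => id, fun _ _ ⟨k', h1, h2⟩ =>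
    ⟨k', h1, isSome_setEntry _ (isSome_setEntry _ h2)⟩⟩

theorem Table.addPair_served (T : Table R) (i : ℕ) (y : Letter g) (j : ℕ) :
    (T.addPair i y j).Served y i :=
  ⟨i, rfl, isSome_setEntry _ (by simp [setEntry])⟩

theorem Table.EntriesLive.addPair {T : Table R} (he : T.EntriesLive) {i j : ℕ} {y : Letter g}
    (h₁ : T.A i y = none) (h₂ : T.A j y.bar = none) (hi : rep T.ρ i = i) (hj : rep T.ρ j = j) :
    (T.addPair i y j).EntriesLive := by
  intro k z l hkl
  rcases (setEntry_pair_eq_some_iff h₁ h₂ k z l).1 hkl with ⟨rfl, -, -⟩ | ⟨rfl, -, -⟩ | h'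
  · exact hi
  · exact hj
  · exact he h'

theorem Table.EntriesLive.define {T : Table R} (h : T.Interp P φ) (he : T.EntriesLive) {i : ℕ}
    {y : Letter g} (hi : T.IsLive i) (h₁ : T.A i y = none) : (T.define i y).EntriesLive := by
  have hnew : T.A (T.ω + 1) y.bar = none := by
    rw [Option.eq_none_iff_forall_ne_some]
    intro l hl
    have := (h.row hl).2
    omega
  intro k z l hkl
  rw [h.rep_define]
  rcases (setEntry_pair_eq_some_iff h₁ hnew k z l).1 hkl with ⟨rfl, -, -⟩ | ⟨rfl, -, -⟩ | h'
  · exact hi.rep_eq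
  · exact h.rep_of_lt (Nat.lt_succ_self _)
  · exact he h'

theorem Table.IsLive.define {T : Table R} (h : T.Interp P φ) {k : ℕ} (hk : T.IsLive k) (i : ℕ)
    (y : Letter g) : (T.define i y).IsLive k :=
  ⟨hk.pos, hk.le.trans (Nat.le_succ _), by rw [h.rep_define, hk.rep_eq]⟩

/-- As the whole word labels a path of `P` from `φ k` to `φ l`, every step of the scan can be
followed in `P`. The last clause is what forces the table to grow: a scan leaves the class of its
starting row with an entry at the first letter. -/
theorem scanLoop_spec (T : Table R) (k l : ℕ) (v : List (Letter g)) (φ : ℕ → X)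
    (h : T.Interp P φ) (he : T.EntriesLive) (hk : T.IsLive k) (hl : T.IsLive l)
    (hrun : P.run (φ k) v = some (φ l)) :
    ∃ φ', (T.scanLoop k l v).Interp P φ' ∧ (T.scanLoop k l v).EntriesLive ∧
      (T.scanLoop k l v).Extends T ∧ (∀ i ≤ T.ω, φ' i = φ i) ∧
      ∀ y u, v = y :: u → (T.scanLoop k l v).Served y k := by
  -- An entry already present at the first letter stays served by `Extends`. Otherwise the forward
  -- scan does not move, and only this situation remains to be treated in each case.
  have hsome : ∀ (T' T : Table R) (k : ℕ) (v : List (Letter g)), T'.Extends T →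
      (∀ y u, v = y :: u → T.forward k v = (k, v) → T'.Served y k) →
      ∀ y u, v = y :: u → T'.Served y k := by
    rintro T' T k v hT' hs y u rfl
    cases hy : T.A k y with
    | some j => exact hT'.served _ _ ⟨k, rfl, by rw [hy]; rfl⟩
    | none => exact hs y u rfl (by simp [Table.forward, hy])
  induction T, k, l, v using Table.scanLoop.induct generalizing φ with
  | case1 T k l =>
    rw [Table.scanLoop, if_pos rfl]
    exact ⟨φ, h, he, .refl _, fun _ _ => rfl, by simp⟩
  | case2 T k l v hv hb hne =>
    obtain ⟨f1, f2, f3, f4⟩ := Table.forward_spec h he v hk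
    rw [f3] at hrun
    obtain ⟨b1, b2, b3, b4⟩ := Table.backward_spec h he _ hl hrun
    have hscan : T.scanLoop k l v = T.coincidence (T.forward k v).1
        (T.backward l (T.forward k v).2).1 := by
      rw [Table.scanLoop, if_neg hv]
      split
      · rw [if_pos hne]
      · next heq => simp [hb] at heq
      · next heq => simp [hb] at heq
    rw [hb] at b3
    obtain ⟨c1, c2, c3, c4⟩ := coincidence_spec h he ⟨f1.pos, f1.le⟩ ⟨b1.pos, b1.le⟩
      (Option.some_injective _ b3)
    rw [hscan]
    refine ⟨φ, c1, c2, c4, fun _ _ => rfl, hsome _ _ _ _ c4 ?_⟩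
    rintro y u rfl hf
    rw [hf] at hb c3 c4 ⊢
    -- The backward scan has consumed the whole word, so its end row has the entry; the coincidence
    -- identifies that row with `k`.
    exact (c4.served _ _ ⟨_, rfl, Table.exists_entry_of_backward_eq_nil h hb⟩).congr c3.symm
  | case3 T k l v hv hb hne =>
    have hscan : T.scanLoop k l v = T := by
      rw [Table.scanLoop, if_neg hv]
      split
      · rw [if_neg hne]
      · next heq => simp [hb] at heq
      · next heq => simp [hb] at heq
    rw [hscan]
    refine ⟨φ, h, he, .refl _, fun _ _ => rfl, hsome _ _ _ _ (.refl _) ?_⟩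
    rintro y u rfl hf
    rw [hf] at hb hne
    refine ⟨k, rfl, ?_⟩
    have := Table.exists_entry_of_backward_eq_nil h hb
    rwa [← not_not.1 hne] at this
  | case4 T k l v hv y' hb =>
    obtain ⟨f1, f2, f3, f4⟩ := Table.forward_spec h he v hk
    rw [f3] at hrun
    obtain ⟨b1, b2, b3, b4⟩ := Table.backward_spec h he _ hl hrun
    have hscan : T.scanLoop k l v = T.addPair (T.forward k v).1 y'
        (T.backward l (T.forward k v).2).1 := by
      rw [Table.scanLoop, if_neg hv]
      split
      · next heq => simp [hb] at heq
      · next heq =>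
        rw [hb] at heq
        obtain ⟨rfl, -⟩ := List.cons.inj heq
        rfl
      · next heq => simp [hb] at heq
    rw [hb] at b2 b3
    obtain ⟨t, ht⟩ := b2
    have hnone := f4 y' t ht.symm
    have hnone' := b4 y' hb
    simp only [PartialAction.run, Option.bind_fun_some] at b3
    rw [hscan]
    refine ⟨φ, h.addPair hnone hnone' ⟨f1.pos, f1.le⟩ ⟨b1.pos, b1.le⟩ b3,
      he.addPair hnone hnone' f1.rep_eq b1.rep_eq, T.addPair_extends _ _ _, fun _ _ => rfl,
      hsome _ _ _ _ (T.addPair_extends _ _ _) ?_⟩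
    rintro y u rfl hf
    rw [hf] at ht ⊢
    obtain ⟨rfl, -⟩ := List.cons.inj ht
    exact T.addPair_served _ _ _
  | case5 T k l v hv y₁ y₂ v' hb ih =>
    obtain ⟨f1, f2, f3, f4⟩ := Table.forward_spec h he v hk
    rw [f3] at hrun
    obtain ⟨b1, b2, b3, b4⟩ := Table.backward_spec h he _ hl hrun
    have hscan : T.scanLoop k l v = (T.define (T.forward k v).1 y₁).scanLoop (T.forward k v).1
        (T.backward l (T.forward k v).2).1 (y₁ :: y₂ :: v') := by
      rw [Table.scanLoop, if_neg hv]
      split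
      · next heq => simp [hb] at heq
      · next heq => simp [hb] at heq
      · next heq =>
        rw [hb] at heq
        obtain ⟨rfl, htail⟩ := List.cons.inj heq
        obtain ⟨rfl, rfl⟩ := List.cons.inj htail
        rfl
    rw [hb] at b2 b3
    obtain ⟨t, ht⟩ := b2
    have hnone := f4 y₁ _ ht.symm
    -- The image of the new row is the next point on the path, which exists because the path is
    -- defined to its end.
    obtain ⟨x, hx, -⟩ := Option.bind_eq_some_iff.1 b3
    have hφ : ∀ i ≤ T.ω, Function.update φ (T.ω + 1) x i = φ i := fun i hi =>
      Function.update_of_ne (by omega) ..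
    obtain ⟨φ', i1, i2, i3, i4, i5⟩ := ih (Function.update φ (T.ω + 1) x)
      (h.define ⟨f1.pos, f1.le⟩ hnone hx) (he.define h f1 hnone) (f1.define h _ _)
      (b1.define h _ _) (by rw [hφ _ f1.le, hφ _ b1.le, b3])
    have hext := i3.trans (T.define_extends h (T.forward k v).1 y₁)
    rw [hscan]
    refine ⟨φ', i1, i2, hext, fun i hi => (i4 i (hi.trans (Nat.le_succ _))).trans (hφ i hi),
      hsome _ _ _ _ hext ?_⟩
    rintro y u rfl hf
    rw [hf] at ht i5
    obtain ⟨rfl, -⟩ := List.cons.inj ht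
    have := i5 y₁ _ rfl
    rwa [hf]

end Tables

/-! ### The enumeration of the example -/

theorem Table.Interp.mem_live_iff {g : ℕ} {R : List (Relation g)} {X : Type*} {T : Table R}
    {P : PartialAction g X} {φ : ℕ → X} (h : T.Interp P φ) {i : ℕ} : i ∈ T.live ↔ T.IsLive i := by
  simp only [Table.live, Finset.mem_filter, Finset.mem_Icc]
  constructor
  · rintro ⟨⟨h1, h2⟩, h3⟩
    exact ⟨h1, h2, rep_of_le h3.ge⟩
  · rintro ⟨h1, h2, h3⟩
    refine ⟨⟨h1, h2⟩, (h.valid.rho_le i).antisymm (not_lt.1 fun hlt => ?_)⟩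
    exact (rep_lt_of_lt hlt).ne h3

theorem Table.le_maxLive {g : ℕ} {R : List (Relation g)} {T : Table R} {i : ℕ} (h : i ∈ T.live) :
    i ≤ T.maxLive :=
  Finset.le_sup (f := id) h

theorem Table.maxLive_le {g : ℕ} {R : List (Relation g)} (T : Table R) : T.maxLive ≤ T.ω :=
  Finset.sup_le fun _ hi => (Finset.mem_Icc.1 (Finset.mem_filter.1 hi).1).2

/-- The table maps to `ptAction`, with the generators going to the base points. -/
def Table.MapsToPt (T : Table wardExample) : Prop :=
  ∃ φ, T.Interp ptAction φ ∧ T.EntriesLive ∧ 2 ≤ T.ω ∧ ∀ i : Fin 2, φ (i + 1) = genPt i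

theorem mapsToPt_initTable : (initTable wardExample).MapsToPt := by
  -- Only the values at rows `1` and `2` matter; a later row gets its image when it is defined.
  refine ⟨fun i => if i = 1 then Pt.base else Pt.fixed, ⟨⟨?_, fun _ => le_rfl, fun _ => id⟩, ?_, ?_,
    fun _ => rep_of_le le_rfl, fun i => ?_⟩, ?_, le_rfl, fun i => ?_⟩
  · intro i y j h
    simp [initTable] at h
  · intro i y j h
    simp [initTable] at h
  · intro i y j h
    simp [initTable] at h
  · have : rep (initTable wardExample).ρ i = i := rep_of_le le_rfl
    rw [this]
  · intro i y j h
    simp [initTable] at h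
  · fin_cases i <;> rfl

theorem Table.MapsToPt.scan {T : Table wardExample} {φ : ℕ → Pt} (h : T.Interp ptAction φ)
    (he : T.EntriesLive) (hω : 2 ≤ T.ω) (hφ : ∀ i : Fin 2, φ (i + 1) = genPt i) {k l : ℕ}
    {v : List (Letter 2)} (hk : T.IsLive k) (hl : T.IsLive l)
    (hrun : ptAction.run (φ k) v = some (φ l)) :
    (T.scan k v l).MapsToPt ∧ (T.scan k v l).Extends T ∧
      ∀ y u, v = y :: u → (T.scan k v l).Served y k := by
  obtain ⟨φ', s1, s2, s3, s4, s5⟩ := scanLoop_spec T k l v φ h he hk hl hrun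
  refine ⟨⟨φ', s1, s2, hω.trans s3.omega_le, fun i => ?_⟩, s3, s5⟩
  rw [s4 _ (by omega), hφ]

theorem Table.MapsToPt.scanPrimary {rels : List (Relation 2)} (hrels : rels ⊆ wardExample)
    {T : Table wardExample} (hT : T.MapsToPt) : (T.scanPrimary rels).MapsToPt := by
  induction rels generalizing T with
  | nil => exact hT
  | cons r rels ih =>
    obtain ⟨φ, h, he, hω, hφ⟩ := hT
    refine ih (List.subset_of_cons_subset hrels) (Table.MapsToPt.scan h he hω hφ
      (h.isLive_rep (by omega) (by omega)) (h.isLive_rep (by omega) (by omega)) ?_).1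
    rw [h.map_rep, h.map_rep, hφ, hφ]
    exact ptAction_run_wardExample (hrels List.mem_cons_self)

theorem Table.MapsToPt.scanSecondary {i : ℕ} {ws : List (List (Letter 2))}
    (hws : ws ⊆ secondaryWords wardExample) {T : Table wardExample} (hT : T.MapsToPt) :
    (T.scanSecondary i ws).MapsToPt ∧ (T.scanSecondary i ws).Extends T := by
  induction ws generalizing T with
  | nil => exact ⟨hT, .refl _⟩
  | cons w ws ih =>
    rw [Table.scanSecondary]
    split
    · next hi =>
      obtain ⟨φ, h, he, hω, hφ⟩ := hT
      have hl := h.mem_live_iff.1 hi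
      obtain ⟨s1, s2, -⟩ := Table.MapsToPt.scan h he hω hφ hl hl
        (ptAction_run_secondaryWords (hws List.mem_cons_self) _)
      obtain ⟨i1, i2⟩ := ih (List.subset_of_cons_subset hws) s1
      exact ⟨i1, i2.trans s2⟩
    · exact ⟨hT, .refl _⟩

/-- The empty word leaves the table and the row `i` untouched, so the word beginning with `b` is
certainly scanned; later scans preserve the served class even if they kill `i`. -/
theorem Table.MapsToPt.served_scanSecondary {i : ℕ} {T : Table wardExample} (hT : T.MapsToPt)
    (hi : i ∈ T.live) :
    (T.scanSecondary i (secondaryWords wardExample)).Served (1, true) i := by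
  have hnil : T.scan i [] i = T := by rw [Table.scan, Table.scanLoop, if_pos rfl]
  have hrun := fun w hw x => ptAction_run_secondaryWords (w := w) hw x
  rw [secondaryWords_wardExample, Table.scanSecondary, if_pos hi, hnil, Table.scanSecondary,
    if_pos hi]
  obtain ⟨φ, h, he, hω, hφ⟩ := hT
  have hl := h.mem_live_iff.1 hi
  obtain ⟨s1, -, s3⟩ := Table.MapsToPt.scan h he hω hφ hl hl
    (hrun _ (by rw [secondaryWords_wardExample]; exact List.mem_cons_of_mem _ List.mem_cons_self) _)
  refine (Table.MapsToPt.scanSecondary ?_ s1).2.served _ _ (s3 _ _ rfl)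
  rw [secondaryWords_wardExample]
  exact fun w hw => List.mem_cons_of_mem _ (List.mem_cons_of_mem _ hw)

theorem mainLoop_spec (M : ℕ) (T : Table wardExample) (i : ℕ) (hT : T.MapsToPt)
    (hs : ∀ k, 1 ≤ k → k < i → T.Served (1, true) k) :
    (mainLoop false M T i).1.MapsToPt ∧
      ∀ k, 1 ≤ k → k < (mainLoop false M T i).2 → (mainLoop false M T i).1.Served (1, true) k := by
  induction T, i using mainLoop.induct false M with
  | case1 T i hi ih =>
    rw [mainLoop, if_pos hi]
    have hround : T.round false i = T.scanSecondary i (secondaryWords wardExample) := rfl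
    rw [hround] at ih ⊢
    obtain ⟨s1, s2⟩ := hT.scanSecondary (i := i) (List.Subset.refl (secondaryWords wardExample))
    refine ih s1 fun k hk hki => ?_
    rcases (Nat.lt_succ_iff.1 hki).lt_or_eq with hki | rfl
    · exact s2.served _ _ (hs k hk hki)
    · by_cases hl : k ∈ T.live
      · exact hT.served_scanSecondary hl
      · obtain ⟨φ, h, -⟩ := hT
        have hr := h.isLive_rep hk (hi.1.trans T.maxLive_le)
        -- A dead row has a smaller representative, which was treated earlier, so its class is
        -- already served.
        have hlt : rep T.ρ k < k := (rep_le _ _).lt_of_ne fun heq =>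
          hl (h.mem_live_iff.2 (heq ▸ hr))
        exact s2.served _ _ ((hs _ hr.pos hlt).congr hr.rep_eq)
  | case2 T i hi =>
    rw [mainLoop, if_neg hi]
    exact ⟨hT, hs⟩

/-- Following the entries at `b` from the representative of row `1` realises the whole forward orbit
of `Pt.base` by live rows, of which there are finitely many. -/
theorem Table.MapsToPt.not_forall_served {T : Table wardExample} (hT : T.MapsToPt) :
    ¬ ∀ k ∈ T.live, T.Served (1, true) k := by
  intro hs
  obtain ⟨φ, h, he, hω, hφ⟩ := hT
  have key : ∀ n, ∃ k ∈ T.live, φ k = Pt.mapB^[n] Pt.base := by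
    intro n
    induction n with
    | zero =>
      exact ⟨_, h.mem_live_iff.2 (h.isLive_rep le_rfl (by omega)), (h.map_rep 1).trans (hφ 0)⟩
    | succ n ih =>
      obtain ⟨k, hk, hn⟩ := ih
      obtain ⟨k', h1, h2⟩ := hs k hk
      obtain ⟨j, hj⟩ := Option.isSome_iff_exists.1 h2
      -- Entries occur only in live rows, so the row serving the class of the live row `k` is `k`
      -- itself.
      obtain rfl : k' = k := by rw [← he hj, h1, (h.mem_live_iff.1 hk).rep_eq]
      have hr := h.valid.entry _ _ _ hj
      refine ⟨j, h.mem_live_iff.2 ⟨hr.1, hr.2, he (h.bar hj)⟩, ?_⟩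
      rw [Function.iterate_succ_apply', ← hn]
      exact (Option.some_injective _ ((ptAction_b _).symm.trans (h.act hj))).symm
  -- The exponent starts at `1` because the orbit lies on line `0` only after the first step away
  -- from `base`.
  refine Set.infinite_of_injective_forall_mem (s := φ '' T.live)
    (f := fun n : ℕ => Pt.mapB^[n + 1] Pt.base) (fun m n hmn => ?_) (fun n => ?_)
    (T.live.finite_toSet.image φ)
  · simp only [Pt.mapB_iterate_base, Pt.line.injEq, true_and] at hmn
    omega
  · obtain ⟨k, hk, hn⟩ := key (n + 1)
    exact ⟨k, hk, hn⟩

theorem not_completes_wardExample (M : ℕ) : ¬ (W wardExample M).Completes := by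
  rintro ⟨T, hT⟩
  simp only [W, process] at hT
  split at hT
  · next hlt =>
    obtain ⟨h1, h2⟩ := mainLoop_spec M _ 1
      (mapsToPt_initTable.scanPrimary (List.Subset.refl wardExample)) (by omega)
    refine h1.not_forall_served fun k hk => h2 k ?_ ((Table.le_maxLive hk).trans_lt hlt)
    exact (Finset.mem_Icc.1 (Finset.mem_filter.1 hk).1).1
  · cases hT

end RackEnum

theorem mainTheorem5 :
    Finite (RackEnum.PresentedRack RackEnum.wardExample) ∧
      ∀ M : ℕ, ¬ (RackEnum.W RackEnum.wardExample M).Completes :=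
  ⟨RackEnum.finite_wardExample, RackEnum.not_completes_wardExample⟩
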